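/- There is an absolute constant $C$ such that the following holds. Let $P$ be a simple $d$-dimensional polytope with $n=d+2$ facets, given as the intersection of the set $H$ of its $n$ facet-defining halfspaces, and let the edges of $P$ be oriented so that every non-empty face of $P$ has a unique sink (a vertex without outgoing edges inside the face). Identify every vertex $v$ with the set of those $h\in H$ that contain $v$ in their interior. Then there is a partition $H=X\,\dot\cup\,Y$ such that the vertices of $P$ are exactly the sets $\{x,y\}$ with $x\in X$, $y\in Y$. For every such partition we have $|X|,|Y|\ge 2$ and, with $L:=1+\lfloor\log_2\min(|X|-1,|Y|-1)\rfloor$, the following holds. For a vertex $v$ let $\Phi(v)$ be the set of all $h\in H\setminus v$ for which there is an edge directed from $v$ to some vertex $w$ with $h\in w$. There is a unique vertex $w^L$ of $P$ with $|\Phi(w^L)\cap X|=|\Phi(w^L)\cap Y|=2^{L-1}$. Let $W^L$ be the set of vertices that can be reached from $w^L$ by a non-empty directed path. Consider the directed random walk that starts at an arbitrary vertex $v_0$, moves in each step along an outgoing edge of the current vertex chosen uniformly at random, and stays put once it has reached the sink of $P$. Then the expected value of the first time $T=\min\{k\ge 0 : v_k\in W^L\}$ satisfies $$\mathbb{E}[T]\;\le\;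 C\log n .$$ -/

import Mathlib

open MeasureTheory
open scoped ENNReal

/-- A `d`-dimensional convex polytope in `ℝ^d` with `n` facets, given by the `n` closed halfspaces
`{p | ⟪normal h, p⟫ ≤ offset h}` that define it, one for each facet. -/
structure FacetPolytope (d n : ℕ) where
  /-- outer normal vector of the halfspace `h` -/
  normal : Fin n → EuclideanSpace ℝ (Fin d)
  /-- right-hand side of the inequality that describes the halfspace `h` -/
  offset : Fin n → ℝ
  normal_ne_zero : ∀ h, normal h ≠ 0
  /-- the intersection of the halfspaces is bounded -/
  bounded : Bornology.IsBounded {p | ∀ h, inner ℝ (normal h) p ≤ offset h}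
  /-- the intersection of the halfspaces is `d`-dimensional -/
  full_dim : (interior {p | ∀ h, inner ℝ (normal h) p ≤ offset h}).Nonempty
  /-- each halfspace defines a non-empty face ... -/
  facet_nonempty : ∀ h,
    {p | (∀ h', inner ℝ (normal h') p ≤ offset h') ∧ inner ℝ (normal h) p = offset h}.Nonempty
  /-- ... of dimension `d - 1`, ... -/
  facet_dim : ∀ h, Module.finrank ℝ (vectorSpan ℝ
    {p | (∀ h', inner ℝ (normal h') p ≤ offset h') ∧ inner ℝ (normal h) p = offset h}) + 1 = d
  /-- ... and different halfspaces define different facets. -/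
  facet_injective : Function.Injective fun h : Fin n =>
    {p | (∀ h', inner ℝ (normal h') p ≤ offset h') ∧ inner ℝ (normal h) p = offset h}

namespace FacetPolytope

variable {d n : ℕ} (P : FacetPolytope d n)

/-- The polytope as a set of points. -/
def body : Set (EuclideanSpace ℝ (Fin d)) :=
  {p | ∀ h, inner ℝ (P.normal h) p ≤ P.offset h}

/-- The vertices of the polytope. -/
abbrev Vertex : Type := ↥(Set.extremePoints ℝ P.body)

/-- The polytope is simple: every vertex lies on exactly `d` facets. -/
def IsSimple : Prop :=
  ∀ v : P.Vertex, {h | inner ℝ (P.normal h) v.1 = P.offset h}.ncard = d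

/-- Two vertices are adjacent if the segment between them is a (one-dimensional) face, i.e. an edge.
The non-empty faces of a polytope are its non-empty exposed subsets. -/
def Adj (u v : P.Vertex) : Prop :=
  u ≠ v ∧ IsExposed ℝ P.body (segment ℝ u.1 v.1)

/-- The set of halfspaces that contain the vertex `v` in their interior; the vertex `v` is
identified with this set. -/
def label (v : P.Vertex) : Set (Fin n) :=
  {h | inner ℝ (P.normal h) v.1 < P.offset h}

/-- The sets `X` and `Y` form a partition of the set of halfspaces such that the vertices of the
polytope are (under the identification by `label`) exactly the sets `{x, y}` with `x ∈ X`,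
`y ∈ Y`. -/
structure IsGridPartition (X Y : Set (Fin n)) : Prop where
  disjoint : Disjoint X Y
  union_eq : X ∪ Y = Set.univ
  range_label : Set.range P.label = {S | ∃ x ∈ X, ∃ y ∈ Y, S = {x, y}}

/-- An orientation of the edges of the polytope: `arrow u v` means that there is an edge between
`u` and `v`, and that it is directed from `u` to `v`. -/
structure Orientation where
  arrow : P.Vertex → P.Vertex → Prop
  adj_of_arrow : ∀ u v, arrow u v → P.Adj u v
  arrow_or_arrow : ∀ u v, P.Adj u v → arrow u v ∨ arrow v u
  asymm : ∀ u v, arrow u v → ¬ arrow v u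

namespace Orientation

variable {P} (O : P.Orientation)

/-- Every non-empty face has a unique sink, where a sink of a face is a vertex of the face without
outgoing edges in the face. -/
def IsUniqueSink : Prop :=
  ∀ F : Set (EuclideanSpace ℝ (Fin d)), IsExposed ℝ P.body F → F.Nonempty →
    ∃! v : P.Vertex, v.1 ∈ F ∧ ∀ u : P.Vertex, u.1 ∈ F → ¬ O.arrow v u

/-- The outmap `Φ`. -/
def outmap (v : P.Vertex) : Set (Fin n) :=
  {h | h ∉ P.label v ∧ ∃ w, O.arrow v w ∧ h ∈ P.label w}

/-- The refined out-degree `(|Φ(v) ∩ X|, |Φ(v) ∩ Y|)`. -/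
noncomputable def refinedOutdegree (X Y : Set (Fin n)) (v : P.Vertex) : ℕ × ℕ :=
  ((O.outmap v ∩ X).ncard, (O.outmap v ∩ Y).ncard)

/-- The vertices that can be reached from `w` by a non-empty directed path. -/
def reachable (w : P.Vertex) : Set P.Vertex :=
  {v | Relation.TransGen O.arrow w v}

open Classical in
/-- Transition probabilities of the directed random walk: from a vertex that is not a sink, move
along an outgoing edge chosen uniformly at random; at a sink, stay. -/
noncomputable def stepProb (u w : P.Vertex) : ℝ≥0∞ :=
  if ∃ z, O.arrow u z then
    if O.arrow u w then (({z | O.arrow u z}.ncard : ℕ) : ℝ≥0∞)⁻¹ else 0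
  else if w = u then 1 else 0

/-- The random sequence `v 0, v 1, …` on the probability space `(Ω, μ)` is a directed random walk
that starts at `v₀`: conditionally on any history, the next position is distributed according to
the transition probabilities from the current position. -/
structure IsDirectedRandomWalk {Ω : Type*} [MeasurableSpace Ω] (μ : Measure Ω)
    (v₀ : P.Vertex) (v : ℕ → Ω → P.Vertex) : Prop where
  measurable : ∀ k a, MeasurableSet {ω | v k ω = a}
  start : ∀ᵐ ω ∂μ, v 0 ω = v₀
  step : ∀ (k : ℕ) (a : ℕ → P.Vertex) (b : P.Vertex),
    μ {ω | (∀ j ≤ k, v j ω = a j) ∧ v (k + 1) ω = b} =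
      μ {ω | ∀ j ≤ k, v j ω = a j} * O.stepProb (a k) b

end Orientation

end FacetPolytope

/-- The first time at which the sequence `v` is in the set `W` (and `∞` if there is none). -/
noncomputable def firstHit {V : Type*} (W : Set V) (v : ℕ → V) : ℝ≥0∞ :=
  ⨅ (k : ℕ) (_ : v k ∈ W), (k : ℝ≥0∞)

/-- The number `L = 1 + ⌊log₂ (min (|X| - 1) (|Y| - 1))⌋` of milestones. -/
noncomputable def numMilestones {n : ℕ} (X Y : Set (Fin n)) : ℕ :=
  1 + Nat.log 2 (min (X.ncard - 1) (Y.ncard - 1))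

/-! In slack coordinates the polytope is the nonnegative orthant cut by two equations, `∑ lam h * s
h = c` with `lam > 0` and `∑ mu h * s h = 0`. By simplicity every vertex has exactly two positive
slacks, one with `mu > 0` and one with `mu < 0`; the signs of `mu` give the partition. Edges change
one of the two coordinates and every nonempty subgrid is the vertex set of a face, so the
orientation becomes a `GridUSO`.

Counting pairs (subgrid, its sink) by the size of the subgrid shows that the refined outdegree is a
bijection onto a box, and so is its restriction to any subgrid (`card_filter_index`). This yields
`w` with outdegree `(q, q)`, and forbids two vertices with equal indices in a common subgrid.

For the walk, let the smaller side index the columns, so there are at most `2q` of them. Let `W` be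
the successors of `w`, and call a column good if `w` has an arrow into it along its row. In a good
column all vertices of rank at most `q` lie in `W` (`IsSuccClosed.card_vOut_lt`), and dually for
rows. A vertex other than `w` outside the good rows and columns dominates `w` in one direction
(`hOut_subset_or_vOut_subset`). Hence from a column rank at most `q` outside `W`, at least a third
of the arrows lead to `W` or a good column. While the column rank exceeds `q`, the `q + 1` arrows to
ranks at most `q` compete with fewer than `2q` horizontal ones. Uniform jumps to lower column ranks
cost harmonic, hence logarithmic, time. `IsSuccClosed.exists_lyapunov` packs this into one function
`g` that drops by at least one on average per step, and `lintegral_firstHit_le` turns it into the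
bound. -/

/-- An orientation of the grid graph on `α × β` for which every nonempty subgrid has a unique
sink: `H y x x'` means `(x, y) → (x', y)`, and `V x y y'` means `(x, y) → (x, y')`. -/
structure GridUSO (α β : Type*) where
  H : β → α → α → Prop
  V : α → β → β → Prop
  H_asymm : ∀ y x x', H y x x' → ¬ H y x' x
  V_asymm : ∀ x y y', V x y y' → ¬ V x y' y
  H_total : ∀ y x x', x ≠ x' → H y x x' ∨ H y x' x
  V_total : ∀ x y y', y ≠ y' → V x y y' ∨ V x y' y
  unique_sink : ∀ (S : Finset α) (T : Finset β), S.Nonempty → T.Nonempty →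
    ∃! v : α × β, (v.1 ∈ S ∧ v.2 ∈ T) ∧ (∀ x' ∈ S, ¬ H v.2 v.1 x') ∧ ∀ y' ∈ T, ¬ V v.1 v.2 y'

/-! ### Binomial moments and counting of subsets -/

/-- The matrix of binomials `i.choose p` is unitriangular: the largest `p` isolates the last value
of `f`, and induction removes it. -/
theorem eq_zero_of_sum_mul_choose_eq_zero (a : ℕ) (f : ℕ → ℤ)
    (h : ∀ p < a, ∑ i ∈ Finset.range a, f i * (i.choose p : ℤ) = 0) : ∀ i < a, f i = 0 := by
  induction a with
  | zero => intro i hi; omega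
  | succ a ih =>
    have ha : f a = 0 := by
      have := h a (by omega)
      rw [Finset.sum_range_succ, Finset.sum_eq_zero] at this
      · simpa using this
      · intro i hi
        rw [Nat.choose_eq_zero_of_lt (Finset.mem_range.1 hi)]; simp
    intro i hi
    rcases Nat.lt_succ_iff_lt_or_eq.1 hi with h1 | rfl
    · refine ih (fun p hp => ?_) i h1
      have := h p (by omega)
      rwa [Finset.sum_range_succ, ha, zero_mul, add_zero] at this
    · exact ha

theorem eq_zero_of_sum_sum_mul_choose_eq_zero (a b : ℕ) (f : ℕ → ℕ → ℤ)
    (h : ∀ p < a, ∀ q < b, ∑ i ∈ Finset.range a, ∑ j ∈ Finset.range b,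
      f i j * ((i.choose p : ℤ) * (j.choose q : ℤ)) = 0) :
    ∀ i < a, ∀ j < b, f i j = 0 := by
  intro i hi
  refine eq_zero_of_sum_mul_choose_eq_zero b (f i) fun q hq => ?_
  refine eq_zero_of_sum_mul_choose_eq_zero a
    (fun i => ∑ j ∈ Finset.range b, f i j * (j.choose q : ℤ)) (fun p hp => ?_) i hi
  rw [← h p hp q hq]
  refine Finset.sum_congr rfl fun i _ => ?_
  rw [Finset.sum_mul]
  exact Finset.sum_congr rfl fun j _ => by ring

-- Such a set is `x` together with `p` elements of `S` outside `R` and different from `x`.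
open Classical in
theorem card_powersetCard_filter_mem_forall_not {α : Type*} (S : Finset α) (R : α → Prop) (x : α)
    (hx : x ∈ S) (hR : ¬ R x) (p : ℕ) :
    ((S.powersetCard (p + 1)).filter fun S' => x ∈ S' ∧ ∀ x' ∈ S', ¬ R x').card =
      (S.card - 1 - (S.filter R).card).choose p := by
  have hc : (((S.filter fun z => ¬ R z)).erase x).card = S.card - 1 - (S.filter R).card := by
    rw [Finset.card_erase_of_mem (by simp [hx, hR])]
    have := Finset.card_filter_add_card_filter_not (s := S) R
    omega
  rw [← hc, ← Finset.card_powersetCard]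
  symm
  refine Finset.card_bij (fun U _ => insert x U) ?_ ?_ ?_
  · intro U hU
    rw [Finset.mem_powersetCard] at hU
    have hxU : x ∉ U := fun h => by simpa using hU.1 h
    simp only [Finset.mem_filter, Finset.mem_powersetCard]
    refine ⟨⟨?_, ?_⟩, by simp, ?_⟩
    · intro z hz
      rcases Finset.mem_insert.1 hz with rfl | hz
      · exact hx
      · have := hU.1 hz
        simp at this; exact this.2.1
    · rw [Finset.card_insert_of_notMem hxU, hU.2]
    · intro z hz
      rcases Finset.mem_insert.1 hz with rfl | hz
      · exact hR
      · have := hU.1 hz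
        simp at this; exact this.2.2
  · intro U hU U' hU' h
    rw [Finset.mem_powersetCard] at hU hU'
    have hxU : x ∉ U := fun h => by simpa using hU.1 h
    have hxU' : x ∉ U' := fun h => by simpa using hU'.1 h
    rw [← Finset.erase_insert hxU, ← Finset.erase_insert hxU', h]
  · intro U hU
    simp only [Finset.mem_filter, Finset.mem_powersetCard] at hU
    refine ⟨U.erase x, ?_, Finset.insert_erase hU.2.1⟩
    rw [Finset.mem_powersetCard]
    refine ⟨?_, ?_⟩
    · intro z hz
      simp only [Finset.mem_erase, Finset.mem_filter] at hz ⊢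
      exact ⟨hz.1, hU.1.1 hz.2, hU.2.2 z hz.2⟩
    · rw [Finset.card_erase_of_mem hU.2.1, hU.1.2]; omega

/-! ### The refined index of a grid orientation -/

namespace GridUSO

variable {α β : Type*} (G : GridUSO α β)

/-- The grid with its two factors exchanged. -/
def swap : GridUSO β α where
  H := G.V
  V := G.H
  H_asymm := G.V_asymm
  V_asymm := G.H_asymm
  H_total := G.V_total
  V_total := G.H_total
  unique_sink S T hS hT := by
    obtain ⟨v, hv, hu⟩ := G.unique_sink T S hT hS
    refine ⟨v.swap, ⟨hv.1.symm, hv.2.symm⟩, fun u hu' => ?_⟩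
    rw [← hu u.swap ⟨hu'.1.symm, hu'.2.symm⟩, Prod.swap_swap]

theorem H_irrefl (y : β) (x : α) : ¬ G.H y x x := fun h => G.H_asymm _ _ _ h h

theorem V_irrefl (x : α) (y : β) : ¬ G.V x y y := fun h => G.V_asymm _ _ _ h h

theorem H_of_not {y : β} {x x' : α} (hne : x ≠ x') (h : ¬ G.H y x x') : G.H y x' x :=
  (G.H_total y x x' hne).resolve_left h

theorem V_of_not {x : α} {y y' : β} (hne : y ≠ y') (h : ¬ G.V x y y') : G.V x y' y :=
  G.swap.H_of_not hne h

-- Double counting of the pairs (subgrid with `p + 1` columns and `q + 1` rows, its sink). Each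
-- subgrid has one sink; a fixed `v` is the sink of those whose other columns and rows avoid its
-- out-neighbours.
open Classical in
theorem sum_choose_mul_choose (S : Finset α) (T : Finset β) (p q : ℕ) :
    ∑ v ∈ S ×ˢ T, ((S.card - 1 - (S.filter (G.H v.2 v.1)).card).choose p) *
      ((T.card - 1 - (T.filter (G.V v.1 v.2)).card).choose q) =
    S.card.choose (p + 1) * T.card.choose (q + 1) := by
  have key : ∀ D ∈ S.powersetCard (p + 1) ×ˢ T.powersetCard (q + 1),
      ((S ×ˢ T).filter fun v => (v.1 ∈ D.1 ∧ ∀ x' ∈ D.1, ¬ G.H v.2 v.1 x') ∧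
        (v.2 ∈ D.2 ∧ ∀ y' ∈ D.2, ¬ G.V v.1 v.2 y')).card = 1 := by
    rintro ⟨S', T'⟩ hD
    simp only [Finset.mem_product, Finset.mem_powersetCard] at hD
    obtain ⟨⟨hS, hSc⟩, hT, hTc⟩ := hD
    obtain ⟨v, hv, hu⟩ := G.unique_sink S' T' (Finset.card_pos.1 (by omega))
      (Finset.card_pos.1 (by omega))
    rw [Finset.card_eq_one]
    refine ⟨v, ?_⟩
    ext u
    simp only [Finset.mem_filter, Finset.mem_product, Finset.mem_singleton]
    constructor
    · rintro ⟨_, h1, h2⟩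
      exact hu u ⟨⟨h1.1, h2.1⟩, h1.2, h2.2⟩
    · rintro rfl
      exact ⟨⟨hS hv.1.1, hT hv.1.2⟩, ⟨hv.1.1, hv.2.1⟩, hv.1.2, hv.2.2⟩
  have h1 : ∑ D ∈ S.powersetCard (p + 1) ×ˢ T.powersetCard (q + 1),
      ((S ×ˢ T).filter fun v => (v.1 ∈ D.1 ∧ ∀ x' ∈ D.1, ¬ G.H v.2 v.1 x') ∧
        (v.2 ∈ D.2 ∧ ∀ y' ∈ D.2, ¬ G.V v.1 v.2 y')).card =
      S.card.choose (p + 1) * T.card.choose (q + 1) := by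
    rw [Finset.sum_congr rfl key]
    simp [Finset.card_powersetCard]
  rw [← h1]
  simp only [Finset.card_filter]
  rw [Finset.sum_comm]
  refine Finset.sum_congr rfl fun v hv => ?_
  rw [Finset.mem_product] at hv
  simp only [← Finset.card_filter]
  rw [← card_powersetCard_filter_mem_forall_not S (G.H v.2 v.1) v.1 hv.1 (G.H_irrefl _ _) p,
    ← card_powersetCard_filter_mem_forall_not T (G.V v.1 v.2) v.2 hv.2 (G.V_irrefl _ _) q,
    ← Finset.card_product, ← Finset.filter_product]

open Classical in
theorem card_filter_H_lt {S : Finset α} {x : α} (y : β) (hx : x ∈ S) :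
    (S.filter (G.H y x)).card < S.card :=
  Finset.card_lt_card (Finset.filter_ssubset.2 ⟨x, hx, G.H_irrefl _ _⟩)

open Classical in
theorem card_filter_V_lt {T : Finset β} {y : β} (x : α) (hy : y ∈ T) :
    (T.filter (G.V x y)).card < T.card :=
  G.swap.card_filter_H_lt x hy

-- The fibre sizes of the complementary index `c` have the same binomial moments as the constant
-- `1`, so by triangularity every fibre is a singleton.
open Classical in
theorem card_filter_index (S : Finset α) (T : Finset β) (i j : ℕ) (hi : i < S.card)
    (hj : j < T.card) :
    ((S ×ˢ T).filter fun v => (S.filter (G.H v.2 v.1)).card = i ∧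
      (T.filter (G.V v.1 v.2)).card = j).card = 1 := by
  set c : α × β → ℕ × ℕ := fun v => (S.card - 1 - (S.filter (G.H v.2 v.1)).card,
    T.card - 1 - (T.filter (G.V v.1 v.2)).card) with hc
  have hmap : ∀ v ∈ S ×ˢ T, c v ∈ Finset.range S.card ×ˢ Finset.range T.card := by
    intro v hv
    rw [Finset.mem_product] at hv
    have := G.card_filter_H_lt v.2 hv.1
    have := G.card_filter_V_lt v.1 hv.2
    simp only [hc, Finset.mem_product, Finset.mem_range]
    omega
  have hz := eq_zero_of_sum_sum_mul_choose_eq_zero S.card T.card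
    (fun i' j' => (((S ×ˢ T).filter fun v => c v = (i', j')).card : ℤ) - 1) ?_
    (S.card - 1 - i) (by omega) (T.card - 1 - j) (by omega)
  · have h1 : ((S ×ˢ T).filter fun v => c v = (S.card - 1 - i, T.card - 1 - j)).card = 1 := by
      have := sub_eq_zero.1 hz
      exact_mod_cast this
    rw [← h1]
    congr 1
    refine Finset.filter_congr fun v hv => ?_
    rw [Finset.mem_product] at hv
    have := G.card_filter_H_lt v.2 hv.1
    have := G.card_filter_V_lt v.1 hv.2
    simp only [hc, Prod.mk.injEq]
    omega
  · intro p hp q hq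
    have e1 : ∑ i ∈ Finset.range S.card, ∑ j ∈ Finset.range T.card,
        (((S ×ˢ T).filter fun v => c v = (i, j)).card : ℤ) *
          ((i.choose p : ℤ) * (j.choose q : ℤ)) =
        (S.card.choose (p + 1) * T.card.choose (q + 1) : ℕ) := by
      rw [← G.sum_choose_mul_choose S T p q, ← Finset.sum_product',
        ← Finset.sum_fiberwise_of_maps_to hmap]
      push_cast
      refine Finset.sum_congr rfl fun k _ => ?_
      rw [Finset.sum_congr rfl (g := fun _ => ((k.1.choose p : ℤ) * (k.2.choose q : ℤ)))]
      · rw [Finset.sum_const, nsmul_eq_mul]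
      · intro v hv
        have := (Finset.mem_filter.1 hv).2
        rw [← this]
    -- The moments of the constant `1`, by the hockey-stick identity.
    have e2 : ∑ i ∈ Finset.range S.card, ∑ j ∈ Finset.range T.card,
          ((i.choose p : ℤ) * (j.choose q : ℤ)) =
        (S.card.choose (p + 1) * T.card.choose (q + 1) : ℕ) := by
      have hs : ∀ a p : ℕ, ∑ i ∈ Finset.range a, i.choose p = a.choose (p + 1) := by
        intro a p
        induction a with
        | zero => simp
        | succ a ih => rw [Finset.sum_range_succ, ih, Nat.choose_succ_succ, add_comm]
      rw [← Finset.sum_mul_sum]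
      rw [← hs, ← hs]; push_cast; rfl
    simp only [sub_mul, one_mul, Finset.sum_sub_distrib]
    rw [e1, e2, sub_self]

open Classical in
/-- A vertex of a subgrid is determined by its refined index. -/
theorem eq_of_index_eq (S : Finset α) (T : Finset β) {u v : α × β}
    (hu : u.1 ∈ S ∧ u.2 ∈ T) (hv : v.1 ∈ S ∧ v.2 ∈ T)
    (hH : (S.filter (G.H u.2 u.1)).card = (S.filter (G.H v.2 v.1)).card)
    (hV : (T.filter (G.V u.1 u.2)).card = (T.filter (G.V v.1 v.2)).card) : u = v := by
  have h := G.card_filter_index S T _ _ (G.card_filter_H_lt v.2 hv.1) (G.card_filter_V_lt v.1 hv.2)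
  refine Finset.card_le_one.1 h.le u ?_ v ?_
  · simp [hu, hH, hV]
  · simp [hv]

/-- Three vertices of a row have a sink, so directed triangles are impossible; each row is a linear
order. -/
theorem H_trans {y : β} {x x' x'' : α} (h : G.H y x x') (h' : G.H y x' x'') : G.H y x x'' := by
  classical
  obtain ⟨v, hv, -⟩ := G.unique_sink {x, x', x''} {y} (by simp) (by simp)
  obtain ⟨⟨h1, h2⟩, h3, -⟩ := hv
  simp only [Finset.mem_insert, Finset.mem_singleton] at h1 h2
  rw [h2] at h3
  rcases h1 with h1 | h1 | h1 <;> rw [h1] at h3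
  · exact absurd h (h3 _ (by simp))
  · exact absurd h' (h3 _ (by simp))
  · refine G.H_of_not ?_ (h3 x (by simp))
    rintro rfl
    exact G.H_asymm _ _ _ h h'

/-- In a `2 × 2` subgrid, two opposite vertices cannot both be sinks. -/
theorem not_opposite_sinks {x x' : α} {y y' : β} (h1 : G.H y x x') (h2 : G.V x y y')
    (h3 : G.H y' x' x) (h4 : G.V x' y' y) : False := by
  classical
  obtain ⟨v, -, hu⟩ := G.unique_sink {x, x'} {y, y'} (by simp) (by simp)
  have e1 := hu (x', y) ⟨by simp, by
    simp [G.H_asymm _ _ _ h1, G.H_irrefl], by simp [G.V_asymm _ _ _ h4, G.V_irrefl]⟩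
  have e2 := hu (x, y') ⟨by simp, by
    simp [G.H_asymm _ _ _ h3, G.H_irrefl], by simp [G.V_asymm _ _ _ h2, G.V_irrefl]⟩
  rw [← e2, Prod.mk.injEq] at e1
  exact G.H_irrefl _ _ (e1.1 ▸ h1)

section Row

variable [Fintype α]

open Classical in
/-- The out-neighbours of `v` in its row. -/
noncomputable def hOut (v : α × β) : Finset α := Finset.univ.filter (G.H v.2 v.1)

@[simp] theorem mem_hOut {v : α × β} {x : α} : x ∈ G.hOut v ↔ G.H v.2 v.1 x := by simp [hOut]

theorem card_hOut_lt (v : α × β) : (G.hOut v).card < Fintype.card α := by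
  classical
  exact G.card_filter_H_lt v.2 (Finset.mem_univ v.1)

theorem hOut_ssubset {y : β} {x x' : α} (h : G.H y x x') : G.hOut (x', y) ⊂ G.hOut (x, y) := by
  refine Finset.ssubset_iff_subset_ne.2 ⟨fun z hz => ?_, fun he => ?_⟩
  · rw [mem_hOut] at *
    exact G.H_trans h hz
  · have : x' ∈ G.hOut (x', y) := by rw [he]; simpa
    rw [mem_hOut] at this
    exact G.H_irrefl _ _ this

/-- The ranks of the out-neighbours of `v` in its row are `0, …, i - 1`. -/
theorem image_card_hOut (v : α × β) :
    (G.hOut v).image (fun x => (G.hOut (x, v.2)).card) = Finset.range (G.hOut v).card ∧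
      Set.InjOn (fun x => (G.hOut (x, v.2)).card) (G.hOut v) := by
  have hinj : Set.InjOn (fun x => (G.hOut (x, v.2)).card) (G.hOut v) := by
    intro x hx x' hx' h
    by_contra hne
    rcases G.H_total v.2 x x' hne with h1 | h1
    · exact (Finset.card_lt_card (G.hOut_ssubset h1)).ne h.symm
    · exact (Finset.card_lt_card (G.hOut_ssubset h1)).ne h
  refine ⟨Finset.eq_of_subset_of_card_le ?_ ?_, hinj⟩
  · intro r hr
    obtain ⟨x, hx, rfl⟩ := Finset.mem_image.1 hr
    rw [Finset.mem_range]
    exact Finset.card_lt_card (G.hOut_ssubset (G.mem_hOut.1 hx))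
  · rw [Finset.card_image_of_injOn hinj, Finset.card_range]

/-- Ranks enumerate the out-neighbours, so a uniform step along a row is a uniform jump to a smaller
rank. -/
theorem sum_hOut (v : α × β) (φ : ℕ → ℝ) :
    ∑ x ∈ G.hOut v, φ (G.hOut (x, v.2)).card = ∑ r ∈ Finset.range (G.hOut v).card, φ r := by
  rw [← (G.image_card_hOut v).1, Finset.sum_image (G.image_card_hOut v).2]

end Row

section Column

variable [Fintype β]

open Classical in
/-- The out-neighbours of `v` in its column. -/
noncomputable def vOut (v : α × β) : Finset β := Finset.univ.filter (G.V v.1 v.2)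

@[simp] theorem mem_vOut {v : α × β} {y : β} : y ∈ G.vOut v ↔ G.V v.1 v.2 y := by simp [vOut]

theorem card_vOut_lt (v : α × β) : (G.vOut v).card < Fintype.card β :=
  G.swap.card_hOut_lt v.swap

theorem sum_vOut (v : α × β) (φ : ℕ → ℝ) :
    ∑ y ∈ G.vOut v, φ (G.vOut (v.1, y)).card = ∑ r ∈ Finset.range (G.vOut v).card, φ r :=
  G.swap.sum_hOut v.swap φ

end Column

variable [Fintype α] [Fintype β]

/-- The refined index is a bijection onto `[0, |α|) × [0, |β|)`. -/
theorem existsUnique_index {i j : ℕ} (hi : i < Fintype.card α) (hj : j < Fintype.card β) :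
    ∃ w, ∀ v, ((G.hOut v).card = i ∧ (G.vOut v).card = j) ↔ v = w := by
  classical
  have h := G.card_filter_index Finset.univ Finset.univ i j hi hj
  obtain ⟨w, hw⟩ := Finset.card_eq_one.1 h
  refine ⟨w, fun v => ?_⟩
  have hv : v ∈ ({w} : Finset (α × β)) ↔ v = w := Finset.mem_singleton
  rw [← hw] at hv
  simp only [Finset.mem_filter, Finset.mem_product, Finset.mem_univ, true_and] at hv
  exact hv

end GridUSO
-- Successor-closed sets and the Lyapunov function
/-- `W` contains the out-neighbours of `w` and is closed under taking out-neighbours. -/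
structure GridUSO.IsSuccClosed {α β : Type*} (G : GridUSO α β) (w : α × β) (W : Set (α × β)) :
    Prop where
  base_H : ∀ x, G.H w.2 w.1 x → (x, w.2) ∈ W
  base_V : ∀ y, G.V w.1 w.2 y → (w.1, y) ∈ W
  step_H : ∀ v ∈ W, ∀ x, G.H v.2 v.1 x → (x, v.2) ∈ W
  step_V : ∀ v ∈ W, ∀ y, G.V v.1 v.2 y → (v.1, y) ∈ W

/-- The mean of `harmonic r` over `r < j` is `harmonic j - 1`: a uniform jump to a smaller rank pays
for exactly one step. -/
theorem sum_range_harmonic (j : ℕ) :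
    ∑ r ∈ Finset.range j, (harmonic r : ℝ) = j * harmonic j - j := by
  induction j with
  | zero => simp
  | succ j ih =>
    rw [Finset.sum_range_succ, ih, harmonic_succ]
    have : (j : ℝ) + 1 ≠ 0 := by positivity
    push_cast
    field_simp
    ring

theorem harmonic_nonneg (j : ℕ) : (0 : ℝ) ≤ harmonic j := by
  rw [harmonic]; push_cast; positivity

theorem one_le_harmonic {j : ℕ} (hj : 0 < j) : (1 : ℝ) ≤ harmonic j := by
  obtain ⟨k, rfl⟩ := Nat.exists_eq_succ_of_ne_zero hj.ne'
  rw [harmonic, Finset.sum_range_succ']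
  push_cast
  have : (0 : ℝ) ≤ ∑ i ∈ Finset.range k, ((i : ℝ) + 1 + 1)⁻¹ := by positivity
  simp at this ⊢
  linarith

theorem sum_le_card_mul_sub {ι : Type*} [DecidableEq ι] (s t : Finset ι) (ht : t ⊆ s)
    (f : ι → ℝ) (M m : ℝ) (hM : ∀ i ∈ s, f i ≤ M) (hm : ∀ i ∈ t, f i ≤ m) :
    ∑ i ∈ s, f i ≤ s.card * M - t.card * (M - m) := by
  rw [← Finset.sum_sdiff ht]
  have h1 : ∑ i ∈ s \ t, f i ≤ (s \ t).card * M := by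
    rw [← nsmul_eq_mul]
    exact Finset.sum_le_card_nsmul _ _ _ fun i hi => hM i (Finset.mem_sdiff.1 hi).1
  have h2 : ∑ i ∈ t, f i ≤ t.card * m := by
    rw [← nsmul_eq_mul]
    exact Finset.sum_le_card_nsmul _ _ _ hm
  have h3 : ((s \ t).card : ℝ) = s.card - t.card := by
    rw [Finset.card_sdiff_of_subset ht, Nat.cast_sub (Finset.card_le_card ht)]
  rw [h3] at h1
  linarith

theorem sum_range_ite_le (j q : ℕ) (hq : q < j) (a b : ℝ) :
    ∑ r ∈ Finset.range j, ((harmonic r : ℝ) + if r ≤ q then a else b) =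
      j * harmonic j - j + ((q + 1) * a + (j - (q + 1)) * b) := by
  rw [Finset.sum_add_distrib, sum_range_harmonic]
  congr 1
  obtain ⟨k, rfl⟩ : ∃ k, j = q + 1 + k := ⟨j - (q + 1), by omega⟩
  rw [Finset.sum_range_add, Finset.sum_congr rfl (g := fun _ => a),
    Finset.sum_congr (s₁ := Finset.range k) rfl (g := fun _ => b)]
  · simp
  · intro r _
    rw [if_neg (by omega)]
  · intro r hr
    rw [Finset.mem_range] at hr
    rw [if_pos (by omega)]

namespace GridUSO

variable {α β : Type*} {G : GridUSO α β} {w : α × β} {W : Set (α × β)}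

theorem IsSuccClosed.swap (hW : G.IsSuccClosed w W) :
    G.swap.IsSuccClosed w.swap {v | v.swap ∈ W} where
  base_H := hW.base_V
  base_V := hW.base_H
  step_H v hv := hW.step_V v.swap hv
  step_V v hv := hW.step_H v.swap hv

/-- If `w → (x, y₀)` and `w → (x₀, z)`, then `(x, z) ∈ W`. -/
theorem IsSuccClosed.prod_mem (hW : G.IsSuccClosed w W) {x : α} {z : β}
    (hx : G.H w.2 w.1 x) (hz : G.V w.1 w.2 z) : (x, z) ∈ W := by
  by_contra hn
  have hxne : w.1 ≠ x := fun h => G.H_irrefl _ _ (h ▸ hx)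
  have hzne : w.2 ≠ z := fun h => G.V_irrefl _ _ (h ▸ hz)
  -- If `(x, z)` is outside `W`, it points to both `(w.1, z)` and `(x, w.2)`, which lie in `W`;
  -- since `w` points to them too, they are opposite sinks of a square.
  refine G.not_opposite_sinks hx hz (G.H_of_not hxne fun h => hn ?_)
    (G.V_of_not hzne fun h => hn ?_)
  · exact hW.step_H _ (hW.base_V z hz) x h
  · exact hW.step_V _ (hW.base_H x hx) z h

/-- A vertex outside `W` in a column through an out-neighbour of `w` has large column rank. -/
theorem IsSuccClosed.card_vOut_lt [Fintype β] (hW : G.IsSuccClosed w W) {v : α × β}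
    (hx : G.H w.2 w.1 v.1) (hv : v ∉ W) : (G.vOut w).card < (G.vOut v).card := by
  -- Inside its column `v` points to each `(v.1, z)` with `z` in `vOut w`, these being in `W`; it
  -- also points to the row of `w`, which makes the inclusion strict.
  refine Finset.card_lt_card (Finset.ssubset_iff_subset_ne.2 ⟨fun z hz => ?_, fun he => ?_⟩)
  · rw [mem_vOut] at *
    by_contra hn
    have hm := hW.prod_mem hx hz
    by_cases hzv : v.2 = z
    · exact hv (by rw [← hzv] at hm; exact hm)
    · exact hv (hW.step_V _ hm _ (G.V_of_not hzv hn))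
  · have hm : w.2 ∈ G.vOut v := by
      rw [mem_vOut]
      by_contra hn
      have hm := hW.base_H _ hx
      by_cases hzv : v.2 = w.2
      · exact hv (by rw [← hzv] at hm; exact hm)
      · exact hv (hW.step_V _ hm _ (G.V_of_not hzv hn))
    rw [← he, mem_vOut] at hm
    exact G.V_irrefl _ _ hm

theorem IsSuccClosed.card_hOut_lt [Fintype α] (hW : G.IsSuccClosed w W) {v : α × β}
    (hy : G.V w.1 w.2 v.2) (hv : v ∉ W) : (G.hOut w).card < (G.hOut v).card :=
  hW.swap.card_vOut_lt (v := v.swap) hy hv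

-- Supplies one side of a subgrid in which `u` and `v` have equal index, to be refuted by
-- `eq_of_index_eq`.
open Classical in
theorem exists_finset_card_filter_H_eq [Fintype α] {u v : α × β} (hx : ¬ G.H u.2 u.1 v.1)
    (h : G.H v.2 v.1 u.1 → ¬ G.hOut u ⊆ G.hOut v) :
    ∃ S : Finset α, u.1 ∈ S ∧ v.1 ∈ S ∧
      (S.filter (G.H u.2 u.1)).card = (S.filter (G.H v.2 v.1)).card := by
  by_cases h0 : G.H v.2 v.1 u.1
  · obtain ⟨x, hxu, hxv⟩ := Finset.not_subset.1 (h h0)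
    rw [mem_hOut] at hxu hxv
    -- Here both have exactly one out-neighbour: `x` for `u`, and `u.1` for `v`. In the other case
    -- both have none.
    refine ⟨{u.1, v.1, x}, by simp, by simp, ?_⟩
    rw [Finset.filter_insert, Finset.filter_insert, Finset.filter_singleton,
      Finset.filter_insert, Finset.filter_insert, Finset.filter_singleton]
    simp [hx, hxu, hxv, h0, G.H_irrefl]
  · refine ⟨{u.1, v.1}, by simp, by simp, ?_⟩
    rw [Finset.filter_insert, Finset.filter_singleton, Finset.filter_insert,
      Finset.filter_singleton]
    simp [hx, h0, G.H_irrefl]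

open Classical in
theorem exists_finset_card_filter_V_eq [Fintype β] {u v : α × β} (hx : ¬ G.V u.1 u.2 v.2)
    (h : G.V v.1 v.2 u.2 → ¬ G.vOut u ⊆ G.vOut v) :
    ∃ T : Finset β, u.2 ∈ T ∧ v.2 ∈ T ∧
      (T.filter (G.V u.1 u.2)).card = (T.filter (G.V v.1 v.2)).card :=
  exists_finset_card_filter_H_eq (G := G.swap) (u := u.swap) (v := v.swap) hx h

variable [Fintype α] [Fintype β]

/-- If neither coordinate of `v ≠ w` is an out-neighbour of `w`, then `v` dominates `w` in one of
the two directions. -/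
theorem hOut_subset_or_vOut_subset {v : α × β} (hne : v ≠ w) (hx : ¬ G.H w.2 w.1 v.1)
    (hy : ¬ G.V w.1 w.2 v.2) :
    (G.H v.2 v.1 w.1 ∧ G.hOut w ⊆ G.hOut v) ∨ (G.V v.1 v.2 w.2 ∧ G.vOut w ⊆ G.vOut v) := by
  classical
  by_contra hcon
  rw [not_or, not_and, not_and] at hcon
  obtain ⟨S, hS1, hS2, hS⟩ := exists_finset_card_filter_H_eq hx hcon.1
  obtain ⟨T, hT1, hT2, hT⟩ := exists_finset_card_filter_V_eq hy hcon.2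
  exact hne (G.eq_of_index_eq S T ⟨hS1, hT1⟩ ⟨hS2, hT2⟩ hS hT).symm

/-- A Lyapunov function for the time at which the directed random walk hits `W`. -/
theorem IsSuccClosed.exists_lyapunov (hW : G.IsSuccClosed w W) {q : ℕ} (hq : 0 < q)
    (hwH : (G.hOut w).card = q) (hwV : (G.vOut w).card = q) (hα : Fintype.card α ≤ 2 * q)
    {h : ℝ} (hh : ∀ j < Fintype.card β, (harmonic j : ℝ) ≤ h) :
    ∃ g : α × β → ℝ, (∀ v, 0 ≤ g v) ∧ (∀ v, g v ≤ 36 * h + 9) ∧ ∀ v ∉ W,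
      0 < (G.hOut v).card + (G.vOut v).card ∧
      ∑ x ∈ G.hOut v, g (x, v.2) + ∑ y ∈ G.vOut v, g (v.1, y) +
        ((G.hOut v).card + (G.vOut v).card : ℕ) ≤
      ((G.hOut v).card + (G.vOut v).card : ℕ) * g v := by
  classical
  have hh0 : 0 ≤ h := by
    have := hh 0 (Fintype.card_pos_iff.2 ⟨w.2⟩)
    simpa using this
  -- `M` bounds `g`. The choice makes `l = M - 3 * h` and `σ + h = M`, while `σ` splits the gap from
  -- `l` to `M` in the ratio `2 : 1`, matching fewer than `2q` horizontal arrows against `q + 1`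
  -- vertical ones.
  obtain ⟨M, hM⟩ : ∃ M, M = 36 * h + 9 := ⟨_, rfl⟩
  obtain ⟨l, hl⟩ : ∃ l, l = 1 + 8 / 9 * M + h := ⟨_, rfl⟩
  obtain ⟨σ, hσ⟩ : ∃ σ, σ = l / 3 + 2 / 3 * M := ⟨_, rfl⟩
  obtain ⟨g, hg⟩ : ∃ g : α × β → ℝ, g = fun v => if v ∈ W then 0 else
    if G.H w.2 w.1 v.1 then 2 / 3 * M + harmonic (G.vOut v).card else
    if (G.vOut v).card ≤ q then l else σ + harmonic (G.vOut v).card := ⟨_, rfl⟩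
  have gW : ∀ v ∈ W, g v = 0 := fun v hv => by rw [hg]; simp [hv]
  have gA : ∀ v ∉ W, G.H w.2 w.1 v.1 → g v = 2 / 3 * M + harmonic (G.vOut v).card :=
    fun v hv h1 => by rw [hg]; simp [hv, h1]
  have gL : ∀ v ∉ W, ¬ G.H w.2 w.1 v.1 → (G.vOut v).card ≤ q → g v = l :=
    fun v hv h1 h2 => by rw [hg]; simp [hv, h1, h2]
  have gM : ∀ v ∉ W, ¬ G.H w.2 w.1 v.1 → ¬ (G.vOut v).card ≤ q →
      g v = σ + harmonic (G.vOut v).card :=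
    fun v hv h1 h2 => by rw [hg]; simp only [hv, h1, h2, if_false]
  have hj : ∀ v, (harmonic (G.vOut v).card : ℝ) ≤ h := fun v => hh _ (G.card_vOut_lt v)
  have hj0 : ∀ v, (0 : ℝ) ≤ harmonic (G.vOut v).card := fun v => harmonic_nonneg _
  have g0 : ∀ v, 0 ≤ g v := by
    intro v
    by_cases h0 : v ∈ W
    · exact (gW v h0).ge
    by_cases h1 : G.H w.2 w.1 v.1
    · rw [gA v h0 h1]; linarith [hj0 v]
    by_cases h2 : (G.vOut v).card ≤ q
    · rw [gL v h0 h1 h2]; linarith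
    · rw [gM v h0 h1 h2]; linarith [hj0 v]
  have gle : ∀ v, g v ≤ M := by
    intro v
    by_cases h0 : v ∈ W
    · rw [gW v h0]; linarith
    by_cases h1 : G.H w.2 w.1 v.1
    · rw [gA v h0 h1]; linarith [hj v]
    by_cases h2 : (G.vOut v).card ≤ q
    · rw [gL v h0 h1 h2]; linarith
    · rw [gM v h0 h1 h2]; linarith [hj v]
  refine ⟨g, g0, fun v => (gle v).trans hM.le, fun v hv => ?_⟩
  have hi : (G.hOut v).card < 2 * q := (G.card_hOut_lt v).trans_le hα
  have hsumH : ∑ x ∈ G.hOut v, g (x, v.2) ≤ (G.hOut v).card * M := by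
    rw [← nsmul_eq_mul]
    exact Finset.sum_le_card_nsmul _ _ _ fun x _ => gle _
  have hsumV : ∑ y ∈ G.vOut v, g (v.1, y) ≤ (G.vOut v).card * M := by
    rw [← nsmul_eq_mul]
    exact Finset.sum_le_card_nsmul _ _ _ fun x _ => gle _
  have hiR : ((G.hOut v).card : ℝ) ≤ 2 * q := by exact_mod_cast hi.le
  have hqR : (1 : ℝ) ≤ q := by exact_mod_cast hq
  have hi0 : (0 : ℝ) ≤ (G.hOut v).card := Nat.cast_nonneg _
  -- Good column: the `q + 1` out-neighbours of column rank at most `q` are in `W` and save `2 / 3 *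
  -- M` each; each of the fewer than `2q` horizontal arrows loses at most `M / 3`.
  by_cases h1 : G.H w.2 w.1 v.1
  · have hjq : q < (G.vOut v).card := hwV ▸ hW.card_vOut_lt h1 hv
    refine ⟨by omega, ?_⟩
    have hV : ∑ y ∈ G.vOut v, g (v.1, y) ≤ ∑ r ∈ Finset.range (G.vOut v).card,
        ((harmonic r : ℝ) + if r ≤ q then 0 else 2 / 3 * M) := by
      rw [← G.sum_vOut v fun r => ((harmonic r : ℝ) + if r ≤ q then 0 else 2 / 3 * M)]
      refine Finset.sum_le_sum fun y _ => ?_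
      by_cases hy : (v.1, y) ∈ W
      · rw [gW _ hy]
        have := harmonic_nonneg (G.vOut (v.1, y)).card
        split_ifs
        · linarith
        · linarith
      · rw [gA _ hy h1, if_neg (not_le.2 (hwV ▸ hW.card_vOut_lt (v := (v.1, y)) h1 hy))]
        linarith
    rw [sum_range_ite_le _ _ hjq] at hV
    rw [gA v hv h1]
    have hH1 := one_le_harmonic (j := (G.vOut v).card) (by omega)
    have hjR : (0 : ℝ) ≤ (G.vOut v).card := Nat.cast_nonneg _
    push_cast
    nlinarith [mul_nonneg hi0 (sub_nonneg.2 hH1),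
      mul_nonneg (show (0 : ℝ) ≤ M by linarith) (sub_nonneg.2 hiR)]
  by_cases h2 : (G.vOut v).card ≤ q
  · rw [gL v hv h1 h2]
    have hjR : ((G.vOut v).card : ℝ) ≤ q := by exact_mod_cast h2
    have hj1 : (0 : ℝ) ≤ (G.vOut v).card := Nat.cast_nonneg _
    by_cases hvw : v = w
    · subst hvw
      refine ⟨by omega, ?_⟩
      rw [Finset.sum_eq_zero fun x hx => gW _ (hW.base_H x (G.mem_hOut.1 hx)),
        Finset.sum_eq_zero fun x hx => gW _ (hW.base_V x (G.mem_vOut.1 hx))]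
      push_cast
      nlinarith
    -- Low column rank: it suffices to find a set `t` of horizontal out-neighbours with `g` at most
    -- `m`, all other values being bounded by `M`. Since the outdegree is at most `3q`, `q` arrows
    -- with a saving of about `M / 3` are enough, hence the `8 / 9` in `l`.
    have key : ∀ (t : Finset α) (m : ℝ), t ⊆ G.hOut v → (∀ x ∈ t, g (x, v.2) ≤ m) →
        ((G.hOut v).card + (G.vOut v).card) * (M / 9 - h) ≤ t.card * (M - m) →
        ∑ x ∈ G.hOut v, g (x, v.2) + ∑ y ∈ G.vOut v, g (v.1, y) +
          ((G.hOut v).card + (G.vOut v).card : ℕ) ≤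
        ((G.hOut v).card + (G.vOut v).card : ℕ) * l := by
      intro t m ht hm hle
      have := sum_le_card_mul_sub (G.hOut v) t ht (fun x => g (x, v.2)) M m (fun x _ => gle _) hm
      push_cast
      rw [hl]
      nlinarith
    -- Good row: the `q + 1` out-neighbours of row rank at most `q` are in `W`.
    by_cases h3 : G.V w.1 w.2 v.2
    · have hiq : q < (G.hOut v).card := hwH ▸ hW.card_hOut_lt h3 hv
      refine ⟨by omega, ?_⟩
      have hcard : ((G.hOut v).filter fun x => (G.hOut (x, v.2)).card ≤ q).card = q + 1 := by
        have hs := G.sum_hOut v fun r => if r ≤ q then 1 else 0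
        rw [Finset.sum_boole, Finset.sum_boole] at hs
        have hs' : ((G.hOut v).filter fun x => (G.hOut (x, v.2)).card ≤ q).card =
          ((Finset.range (G.hOut v).card).filter fun r => r ≤ q).card := by exact_mod_cast hs
        rw [hs', show (Finset.range (G.hOut v).card).filter (fun r => r ≤ q) =
          Finset.range (q + 1) by ext r; simp only [Finset.mem_filter, Finset.mem_range]; omega,
          Finset.card_range]
      refine key ((G.hOut v).filter fun x => (G.hOut (x, v.2)).card ≤ q) 0
        (Finset.filter_subset _ _) (fun x hx => ?_) ?_
      · refine (gW _ ?_).le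
        by_contra hn
        have := hwH ▸ hW.card_hOut_lt (v := (x, v.2)) h3 hn
        exact absurd (Finset.mem_filter.1 hx).2 (not_le.2 this)
      · rw [hcard]
        push_cast
        have : (0 : ℝ) ≤ M / 9 - h := by linarith
        nlinarith
    -- Horizontal dominance gives `q` arrows into good columns; vertical dominance would force
    -- column rank above `q`.
    · rcases hOut_subset_or_vOut_subset hvw h1 h3 with h4 | h4
      · have hc := Finset.card_le_card h4.2
        refine ⟨by omega, key (G.hOut w) (2 / 3 * M + h) h4.2 (fun x hx => ?_) ?_⟩
        · by_cases hxW : (x, v.2) ∈ W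
          · rw [gW _ hxW]; linarith
          · rw [gA _ hxW (G.mem_hOut.1 hx)]
            linarith [hj (x, v.2)]
        · rw [hwH]
          have : (0 : ℝ) ≤ M / 9 - h := by linarith
          nlinarith
      · exfalso
        have : (G.vOut w).card < (G.vOut v).card := by
          refine Finset.card_lt_card (Finset.ssubset_iff_subset_ne.2 ⟨h4.2, fun he => ?_⟩)
          have hm : w.2 ∈ G.vOut w := by rw [he]; simpa using h4.1
          rw [mem_vOut] at hm
          exact G.V_irrefl _ _ hm
        omega
  -- High column rank outside the good columns: `q + 1` vertical arrows drop to level `l`, and the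
  -- horizontal ones may rise to `M`.
  · have hjq : q < (G.vOut v).card := not_le.1 h2
    refine ⟨by omega, ?_⟩
    have hl0 : 0 ≤ l := by linarith
    have hlM : l ≤ M := by linarith
    have hV : ∑ y ∈ G.vOut v, g (v.1, y) ≤ ∑ r ∈ Finset.range (G.vOut v).card,
        ((harmonic r : ℝ) + if r ≤ q then l else σ) := by
      rw [← G.sum_vOut v fun r => ((harmonic r : ℝ) + if r ≤ q then l else σ)]
      refine Finset.sum_le_sum fun y _ => ?_
      have := harmonic_nonneg (G.vOut (v.1, y)).card
      by_cases hy : (v.1, y) ∈ W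
      · rw [gW _ hy]
        split_ifs
        · linarith
        · linarith
      · split_ifs with h5
        · rw [gL _ hy h1 h5]; linarith
        · rw [gM _ hy h1 h5]; linarith
    rw [sum_range_ite_le _ _ hjq] at hV
    rw [gM v hv h1 h2]
    have hH1 := one_le_harmonic (j := (G.vOut v).card) (by omega)
    push_cast
    have e1 : 0 ≤ (G.hOut v).card * ((harmonic (G.vOut v).card : ℝ) - 1) :=
      mul_nonneg hi0 (sub_nonneg.2 hH1)
    have e2 : 0 ≤ (M - l) * (2 * ((q : ℝ) + 1) - (G.hOut v).card) :=
      mul_nonneg (by linarith) (by linarith)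
    rw [hσ] at hV ⊢
    nlinarith

end GridUSO
-- Hitting times from a Lyapunov function
-- The hitting time counts the indices `i` up to which `W` has been avoided; if `W` is never hit,
-- the series is infinite.
open Classical in
theorem firstHit_le_tsum {V : Type*} (W : Set V) (v : ℕ → V) :
    firstHit W v ≤ ∑' i : ℕ, if ∀ j ≤ i, v j ∉ W then (1 : ℝ≥0∞) else 0 := by
  by_cases h : ∃ k, v k ∈ W
  · have hk := Nat.find_spec h
    refine (iInf₂_le (Nat.find h) hk).trans ?_
    refine le_trans ?_ (ENNReal.sum_le_tsum (Finset.range (Nat.find h)))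
    rw [Finset.sum_congr rfl (g := fun _ => 1)]
    · simp
    · intro i hi
      rw [if_pos]
      intro j hj
      exact Nat.find_min h (hj.trans_lt (Finset.mem_range.1 hi))
  · push Not at h
    simp [h]

open Classical in
/-- Over a trajectory cylinder, the expected remaining time (truncated at `N`) before `W` is hit is
bounded by a Lyapunov function. -/
theorem setLIntegral_remaining_le {V : Type*} [Finite V] {Ω : Type*} [MeasurableSpace Ω]
    (μ : Measure Ω) (W : Set V) (v : ℕ → Ω → V)
    (hv : ∀ k a, MeasurableSet {ω | v k ω = a}) (p : V → V → ℝ≥0∞) (g : V → ℝ≥0∞)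
    (hstep : ∀ (k : ℕ) (a : ℕ → V) (b : V),
      μ {ω | (∀ j ≤ k, v j ω = a j) ∧ v (k + 1) ω = b} =
        μ {ω | ∀ j ≤ k, v j ω = a j} * p (a k) b)
    (hg : ∀ x ∉ W, 1 + ∑ᶠ y, p x y * g y ≤ g x) (N : ℕ) :
    ∀ (k : ℕ) (a : ℕ → V), (∀ j ≤ k, a j ∉ W) →
      ∫⁻ ω in {ω | ∀ j ≤ k, v j ω = a j}, ∑ i ∈ Finset.range N,
        (if ∀ j ≤ k + i, v j ω ∉ W then (1 : ℝ≥0∞) else 0) ∂μ ≤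
      g (a k) * μ {ω | ∀ j ≤ k, v j ω = a j} := by
  cases nonempty_fintype V
  simp only [finsum_eq_sum_of_fintype] at hg
  have hC : ∀ (k : ℕ) (a : ℕ → V), MeasurableSet {ω | ∀ j ≤ k, v j ω = a j} := by
    intro k a
    simp only [Set.ofPred_forall]
    exact MeasurableSet.iInter fun j => MeasurableSet.iInter fun _ => hv j (a j)
  induction N with
  | zero => intro k a _; simp
  | succ N ih =>
    intro k a ha
    have hsplit : ∀ ω ∈ {ω | ∀ j ≤ k, v j ω = a j}, ∑ i ∈ Finset.range (N + 1),
        (if ∀ j ≤ k + i, v j ω ∉ W then (1 : ℝ≥0∞) else 0) =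
        1 + ∑ i ∈ Finset.range N,
          (if ∀ j ≤ k + 1 + i, v j ω ∉ W then (1 : ℝ≥0∞) else 0) := by
      intro ω hω
      rw [Finset.sum_range_succ', add_comm]
      congr 1
      · rw [if_pos]
        intro j hj
        rw [hω j (by simpa using hj)]
        exact ha j (by simpa using hj)
      · refine Finset.sum_congr rfl fun i _ => ?_
        rw [show k + (i + 1) = k + 1 + i by ring]
    rw [setLIntegral_congr_fun (hC k a) hsplit, lintegral_add_left measurable_const]
    rw [setLIntegral_const, one_mul]
    -- Conditioning on the next position: each piece is again a cylinder, to which the induction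
    -- hypothesis with horizon `N` applies.
    have hU : {ω | ∀ j ≤ k, v j ω = a j} =
        ⋃ b ∈ (Finset.univ : Finset V), {ω | (∀ j ≤ k, v j ω = a j) ∧ v (k + 1) ω = b} := by
      ext ω; simp
    have hcyl : ∀ b, {ω | (∀ j ≤ k, v j ω = a j) ∧ v (k + 1) ω = b} =
        {ω | ∀ j ≤ k + 1, v j ω = (Function.update a (k + 1) b) j} := by
      intro b
      ext ω
      simp only [Set.mem_ofPred_eq]
      constructor
      · rintro ⟨h1, h2⟩ j hj
        rcases Nat.le_succ_iff.1 hj with h | rfl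
        · rw [Function.update_of_ne (by omega)]; exact h1 j h
        · simpa using h2
      · intro h
        refine ⟨fun j hj => ?_, by simpa using h (k + 1) le_rfl⟩
        have := h j (by omega)
        rwa [Function.update_of_ne (by omega)] at this
    have hbound : ∀ b, ∫⁻ ω in {ω | (∀ j ≤ k, v j ω = a j) ∧ v (k + 1) ω = b},
        ∑ i ∈ Finset.range N, (if ∀ j ≤ k + 1 + i, v j ω ∉ W then (1 : ℝ≥0∞) else 0) ∂μ ≤
        μ {ω | ∀ j ≤ k, v j ω = a j} * (p (a k) b * g b) := by
      intro b
      by_cases hb : b ∈ W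
      -- Once `b` is in `W`, all later indicators vanish.
      · refine le_trans (le_of_eq ?_) zero_le
        rw [setLIntegral_congr_fun (g := fun _ => 0) ?_ ?_]
        · simp
        · rw [hcyl]; exact hC _ _
        · intro ω hω
          refine Finset.sum_eq_zero fun i _ => if_neg fun h => h (k + 1) (by omega) ?_
          rw [hω.2]; exact hb
      · rw [← mul_assoc, ← hstep, hcyl, mul_comm _ (g b)]
        have := ih (k + 1) (Function.update a (k + 1) b) ?_
        · simpa using this
        · intro j hj
          rcases Nat.le_succ_iff.1 hj with h | rfl
          · rw [Function.update_of_ne (by omega)]; exact ha j h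
          · simpa using hb
    calc _ ≤ μ {ω | ∀ j ≤ k, v j ω = a j} +
          ∑ b, μ {ω | ∀ j ≤ k, v j ω = a j} * (p (a k) b * g b) := by
          gcongr
          conv_lhs => rw [hU]
          rw [lintegral_biUnion_finset]
          · exact Finset.sum_le_sum fun b _ => hbound b
          · intro b _ b' _ hne
            refine Set.disjoint_left.2 fun ω h h' => hne ?_
            rw [← h.2, ← h'.2]
          · intro b _
            rw [hcyl]; exact hC _ _
      _ = (1 + ∑ b, p (a k) b * g b) * μ {ω | ∀ j ≤ k, v j ω = a j} := by
          rw [← Finset.mul_sum, add_mul, one_mul, mul_comm (μ _)]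
      _ ≤ _ := by
          gcongr
          exact hg _ (ha k le_rfl)

/-- A Lyapunov function bounds the expected hitting time of a Markov chain on a finite set. -/
theorem lintegral_firstHit_le {V : Type*} [Finite V] {Ω : Type*} [MeasurableSpace Ω]
    (μ : Measure Ω) [IsProbabilityMeasure μ] (W : Set V) (v₀ : V) (v : ℕ → Ω → V)
    (hv : ∀ k a, MeasurableSet {ω | v k ω = a}) (p : V → V → ℝ≥0∞) (g : V → ℝ≥0∞)
    (hstart : ∀ᵐ ω ∂μ, v 0 ω = v₀)
    (hstep : ∀ (k : ℕ) (a : ℕ → V) (b : V),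
      μ {ω | (∀ j ≤ k, v j ω = a j) ∧ v (k + 1) ω = b} =
        μ {ω | ∀ j ≤ k, v j ω = a j} * p (a k) b)
    (hg : ∀ x ∉ W, 1 + ∑ᶠ y, p x y * g y ≤ g x) :
    ∫⁻ ω, firstHit W (fun k => v k ω) ∂μ ≤ g v₀ := by
  classical
  by_cases h0 : v₀ ∈ W
  · refine le_trans (le_of_eq ?_) zero_le
    rw [lintegral_congr_ae (g := fun _ => 0), lintegral_zero]
    filter_upwards [hstart] with ω hω
    refine le_antisymm ((iInf₂_le 0 ?_).trans (by simp)) zero_le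
    change v 0 ω ∈ W
    rw [hω]; exact h0
  have hmeas : ∀ i : ℕ, Measurable fun ω => if ∀ j ≤ i, v j ω ∉ W then (1 : ℝ≥0∞) else 0 := by
    intro i
    refine Measurable.ite ?_ measurable_const measurable_const
    simp only [Set.ofPred_forall]
    refine MeasurableSet.iInter fun j => MeasurableSet.iInter fun _ => ?_
    have : {ω | v j ω ∉ W} = ⋃ a ∈ Wᶜ, {ω | v j ω = a} := by ext ω; simp
    rw [this]
    exact MeasurableSet.biUnion (Set.to_countable _) fun a _ => hv j a
  refine (lintegral_mono fun ω => firstHit_le_tsum W fun k => v k ω).trans ?_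
  rw [lintegral_tsum fun i => (hmeas i).aemeasurable]
  refine ENNReal.tsum_le_of_sum_range_le fun N => ?_
  rw [← lintegral_finsetSum _ fun i _ => hmeas i]
  have h := setLIntegral_remaining_le μ W v hv p g hstep hg N 0 (fun _ => v₀) (by simp [h0])
  have hset : {ω | ∀ j ≤ 0, v j ω = v₀} = {ω | v 0 ω = v₀} := by ext ω; simp
  have hae : {ω | v 0 ω = v₀} =ᵐ[μ] Set.univ := by
    rw [ae_eq_univ]; exact hstart
  rw [hset, setLIntegral_congr hae, measure_congr hae, setLIntegral_univ, measure_univ,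
    mul_one] at h
  simpa using h
-- Slack coordinates, vertices and faces of the polytope
namespace FacetPolytope

variable {d n : ℕ} (P : FacetPolytope d n)

/-- The slack of the inequality `h` at the point `p`. -/
noncomputable def slack (p : EuclideanSpace ℝ (Fin d)) (h : Fin n) : ℝ :=
  P.offset h - inner ℝ (P.normal h) p

theorem mem_body_iff {p : EuclideanSpace ℝ (Fin d)} : p ∈ P.body ↔ ∀ h, 0 ≤ P.slack p h := by
  simp [body, slack]

theorem mem_label_iff {v : P.Vertex} {h : Fin n} : h ∈ P.label v ↔ 0 < P.slack v.1 h := by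
  simp [label, slack]

theorem slack_nonneg (v : P.Vertex) (h : Fin n) : 0 ≤ P.slack v.1 h :=
  P.mem_body_iff.1 (extremePoints_subset v.2) h

theorem notMem_label_iff {v : P.Vertex} {h : Fin n} : h ∉ P.label v ↔ P.slack v.1 h = 0 := by
  rw [mem_label_iff, not_lt]
  exact ⟨fun hle => le_antisymm hle (P.slack_nonneg v h), fun he => he.le⟩

theorem slack_add_smul (p e : EuclideanSpace ℝ (Fin d)) (t : ℝ) (h : Fin n) :
    P.slack (p + t • e) h = P.slack p h - t * inner ℝ (P.normal h) e := by
  simp only [slack, inner_add_right, inner_smul_right]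
  ring

theorem slack_add_smul_sub (p q : EuclideanSpace ℝ (Fin d)) (t : ℝ) (h : Fin n) :
    P.slack (p + t • (p - q)) h = (1 + t) * P.slack p h - t * P.slack q h := by
  rw [slack_add_smul, inner_sub_right]
  simp only [slack]
  ring

theorem slack_combination {p q : EuclideanSpace ℝ (Fin d)} {a b : ℝ} (hab : a + b = 1)
    (h : Fin n) : P.slack (a • p + b • q) h = a * P.slack p h + b * P.slack q h := by
  simp only [slack, inner_add_right, inner_smul_right]
  linear_combination (-P.offset h) * hab

theorem isClosed_body : IsClosed P.body := by
  simp only [body, Set.ofPred_forall]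
  exact isClosed_iInter fun h => isClosed_le (by fun_prop) continuous_const

theorem isCompact_body : IsCompact P.body :=
  Metric.isCompact_of_isClosed_isBounded P.isClosed_body P.bounded

theorem convex_body : Convex ℝ P.body := by
  intro p hp q hq a b ha hb hab
  rw [mem_body_iff] at *
  intro h
  rw [P.slack_combination hab]
  exact add_nonneg (mul_nonneg ha (hp h)) (mul_nonneg hb (hq h))

theorem exists_forall_slack_pos : ∃ p, ∀ h, 0 < P.slack p h := by
  obtain ⟨p, hp⟩ := P.full_dim
  refine ⟨p, fun h => ?_⟩
  have hc : Filter.Tendsto (fun t : ℝ => p + t • P.normal h) (nhdsWithin 0 (Set.Ioi 0))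
      (nhds p) := by
    have : Continuous fun t : ℝ => p + t • P.normal h := by fun_prop
    simpa using (this.tendsto 0).mono_left nhdsWithin_le_nhds
  have he := hc.eventually (mem_interior_iff_mem_nhds.1 hp)
  obtain ⟨t, ht, ht0⟩ := (he.and self_mem_nhdsWithin).exists
  have h1 := P.mem_body_iff.1 ht h
  rw [slack_add_smul, real_inner_self_eq_norm_sq] at h1
  have h2 : 0 < ‖P.normal h‖ := norm_pos_iff.2 (P.normal_ne_zero h)
  have h3 : (0 : ℝ) < t := ht0
  have : 0 < t * ‖P.normal h‖ ^ 2 := by positivity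
  linarith

theorem body_nonempty : P.body.Nonempty := by
  obtain ⟨p, hp⟩ := P.exists_forall_slack_pos
  exact ⟨p, P.mem_body_iff.2 fun h => (hp h).le⟩

/-- Otherwise the body would contain a line in direction `e`. -/
theorem eq_zero_of_forall_inner_eq_zero {e : EuclideanSpace ℝ (Fin d)}
    (he : ∀ h, inner ℝ (P.normal h) e = 0) : e = 0 := by
  by_contra hne
  obtain ⟨p, hp⟩ := P.body_nonempty
  obtain ⟨R, hR⟩ := P.bounded.exists_norm_le
  have hmem : ∀ t : ℝ, p + t • e ∈ P.body := by
    intro t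
    rw [mem_body_iff]
    intro h
    rw [slack_add_smul, he, mul_zero, sub_zero]
    exact P.mem_body_iff.1 hp h
  have hpos : 0 < ‖e‖ := norm_pos_iff.2 hne
  have h1 := hR _ (hmem ((R + ‖p‖ + 1) / ‖e‖))
  have h2 : ‖((R + ‖p‖ + 1) / ‖e‖) • e‖ = |R + ‖p‖ + 1| := by
    rw [norm_smul, norm_div, norm_norm, div_mul_cancel₀ _ hpos.ne', Real.norm_eq_abs]
  have h3 : ‖((R + ‖p‖ + 1) / ‖e‖) • e‖ ≤ ‖p + ((R + ‖p‖ + 1) / ‖e‖) • e‖ + ‖p‖ := by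
    have := norm_sub_le (p + ((R + ‖p‖ + 1) / ‖e‖) • e) p
    simpa using this
  rw [h2] at h3
  linarith [le_abs_self (R + ‖p‖ + 1)]

theorem slack_injective : Function.Injective P.slack := by
  intro p q hpq
  rw [← sub_eq_zero]
  refine P.eq_zero_of_forall_inner_eq_zero fun h => ?_
  have := congrFun hpq h
  simp only [slack] at this
  rw [inner_sub_right]
  linarith

/-- The outer normals of a polytope have a positive linear dependency. -/
theorem exists_pos_dependency : ∃ lam : Fin n → ℝ, (∀ h, 0 < lam h) ∧
    ∀ e, ∑ h, lam h * inner ℝ (P.normal h) e = 0 := by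
  classical
  have hcont : ∀ h, Continuous fun p => P.slack p h := fun h => by unfold slack; fun_prop
  -- Maximise the product of the slacks. The maximiser is interior, and vanishing directional
  -- derivatives are the dependency, with the product of the other slacks as coefficient.
  obtain ⟨p, hp, hmax⟩ := P.isCompact_body.exists_isMaxOn P.body_nonempty
    (f := fun p => ∏ h, P.slack p h) (by fun_prop)
  obtain ⟨p₀, hp₀⟩ := P.exists_forall_slack_pos
  have hprod : 0 < ∏ h, P.slack p h :=
    (Finset.prod_pos fun h _ => hp₀ h).trans_le
      (hmax (P.mem_body_iff.2 fun h => (hp₀ h).le))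
  have hpos : ∀ h, 0 < P.slack p h := by
    intro h
    refine lt_of_le_of_ne (P.mem_body_iff.1 hp h) fun h0 => hprod.ne' ?_
    exact Finset.prod_eq_zero (Finset.mem_univ h) h0.symm
  refine ⟨fun h => ∏ h' ∈ Finset.univ.erase h, P.slack p h',
    fun h => Finset.prod_pos fun h' _ => hpos h', fun e => ?_⟩
  have hder : HasDerivAt (fun t : ℝ => ∏ h, (P.slack p h - t * inner ℝ (P.normal h) e))
      (∑ h, (∏ h' ∈ Finset.univ.erase h, (P.slack p h' - 0 * inner ℝ (P.normal h') e)) •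
        (-inner ℝ (P.normal h) e)) 0 := by
    refine HasDerivAt.fun_finsetProd fun h _ => ?_
    simpa using ((hasDerivAt_id (0 : ℝ)).mul_const (inner ℝ (P.normal h) e)).const_sub
      (P.slack p h)
  have hloc : IsLocalMax (fun t : ℝ => ∏ h, (P.slack p h - t * inner ℝ (P.normal h) e)) 0 := by
    have hev : ∀ᶠ t : ℝ in nhds 0, ∀ h, 0 < P.slack p h - t * inner ℝ (P.normal h) e := by
      rw [Filter.eventually_all]
      intro h
      have hc : Continuous fun t : ℝ => P.slack p h - t * inner ℝ (P.normal h) e := by fun_prop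
      exact hc.tendsto 0 |>.eventually (lt_mem_nhds (by simpa using hpos h))
    filter_upwards [hev] with t ht
    simp only [← slack_add_smul] at ht ⊢
    simpa using hmax (P.mem_body_iff.2 fun h => (ht h).le)
  have h0 := hloc.hasDerivAt_eq_zero hder
  simp only [zero_mul, sub_zero, smul_eq_mul, mul_neg, Finset.sum_neg_distrib, neg_eq_zero] at h0
  exact h0

/-- The slack vectors of the points of `ℝ^d` form the affine space that is given by two linear
equations. -/
structure IsSlackSystem (lam mu : Fin n → ℝ) (c : ℝ) : Prop where
  lam_pos : ∀ h, 0 < lam h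
  pos : 0 < c
  sum_lam : ∀ p, ∑ h, lam h * P.slack p h = c
  sum_mu : ∀ p, ∑ h, mu h * P.slack p h = 0
  exists_slack : ∀ s : Fin n → ℝ, ∑ h, lam h * s h = c → ∑ h, mu h * s h = 0 → ∃ p, P.slack p = s

theorem exists_isSlackSystem (hn : n = d + 2) : ∃ lam mu c, P.IsSlackSystem lam mu c := by
  classical
  obtain ⟨lam, hlam, hdep⟩ := P.exists_pos_dependency
  obtain ⟨p₀, hp₀⟩ := P.exists_forall_slack_pos
  let A : EuclideanSpace ℝ (Fin d) →ₗ[ℝ] (Fin n → ℝ) :=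
    LinearMap.pi fun h => (innerSL ℝ (P.normal h)).toLinearMap
  have hA : ∀ e h, A e h = inner ℝ (P.normal h) e := fun e h => rfl
  -- The slack vectors span at most `d + 1 < n` dimensions, so some nonzero functional `f` vanishes
  -- on all of them; its coefficients are `mu`.
  let B : (EuclideanSpace ℝ (Fin d) × ℝ) →ₗ[ℝ] (Fin n → ℝ) :=
    A.coprod (LinearMap.toSpanSingleton ℝ _ (P.slack p₀))
  have hB : LinearMap.range B < ⊤ := by
    rw [lt_top_iff_ne_top]
    intro htop
    have h1 := LinearMap.finrank_range_le B
    rw [htop, finrank_top] at h1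
    simp at h1
    omega
  obtain ⟨f, hf, hfB⟩ := Submodule.exists_le_ker_of_lt_top _ hB
  have hf_eq : ∀ s, f s = ∑ h, f (Pi.single h 1) * s h := by
    intro s
    rw [LinearMap.pi_apply_eq_sum_univ f s]
    refine Finset.sum_congr rfl fun h _ => ?_
    rw [smul_eq_mul, mul_comm]
    congr 2
    ext j
    simp [Pi.single_apply, eq_comm]
  have hfA : ∀ e, f (A e) = 0 := fun e => hfB ⟨(e, 0), by simp [B]⟩
  have hfp : f (P.slack p₀) = 0 := hfB ⟨(0, 1), by simp [B]⟩
  have hslack : ∀ p, P.slack p = P.slack p₀ - A (p - p₀) := by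
    intro p
    ext h
    rw [Pi.sub_apply, hA, inner_sub_right]
    simp only [slack]
    ring
  let g : (Fin n → ℝ) →ₗ[ℝ] ℝ := ∑ h, lam h • LinearMap.proj h
  have hg_eq : ∀ s, g s = ∑ h, lam h * s h := by
    intro s
    simp [g]
  have hgA : ∀ e, g (A e) = 0 := fun e => by rw [hg_eq]; exact hdep e
  have : NeZero n := ⟨by omega⟩
  have hc : 0 < g (P.slack p₀) := by
    rw [hg_eq]
    exact Finset.sum_pos (fun h _ => mul_pos (hlam h) (hp₀ h)) Finset.univ_nonempty
  -- Both functionals vanish on the range of `A`; as they are independent, their common kernel has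
  -- dimension `n - 2 = d`, the rank of `A`.
  have hker : LinearMap.range A = LinearMap.ker (g.prod f) := by
    refine Submodule.eq_of_le_of_finrank_eq ?_ ?_
    · rintro _ ⟨e, rfl⟩
      simp [hgA, hfA]
    · have hinj : Function.Injective A := by
        rw [injective_iff_map_eq_zero]
        intro e he
        exact P.eq_zero_of_forall_inner_eq_zero fun h => by rw [← hA, he]; rfl
      have hsurj : LinearMap.range (g.prod f) = ⊤ := by
        rw [LinearMap.range_eq_top]
        obtain ⟨s, hs⟩ : ∃ s, f s ≠ 0 := by
          by_contra hcon
          push Not at hcon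
          exact hf (LinearMap.ext hcon)
        rintro ⟨a, b⟩
        refine ⟨(b / f s) • s + ((a - b / f s * g s) / g (P.slack p₀)) • P.slack p₀, ?_⟩
        refine Prod.ext ?_ ?_
        · rw [LinearMap.prod_apply]
          change g _ = a
          rw [map_add, map_smul, map_smul, smul_eq_mul, smul_eq_mul]
          field_simp
          ring
        · rw [LinearMap.prod_apply]
          change f _ = b
          rw [map_add, map_smul, map_smul, smul_eq_mul, smul_eq_mul, hfp]
          field_simp
          ring
      have h1 := LinearMap.finrank_range_add_finrank_ker (g.prod f)
      rw [hsurj, finrank_top] at h1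
      rw [LinearMap.finrank_range_of_inj hinj]
      simp at h1 ⊢
      omega
  refine ⟨lam, fun h => f (Pi.single h 1), g (P.slack p₀), hlam, hc, fun p => ?_, fun p => ?_,
    fun s hs1 hs2 => ?_⟩
  · rw [← hg_eq, hslack p, map_sub, hgA, sub_zero]
  · rw [← hf_eq, hslack p, map_sub, hfA, sub_zero, hfp]
  · rw [← hg_eq] at hs1
    rw [← hf_eq] at hs2
    have : P.slack p₀ - s ∈ LinearMap.range A := by
      rw [hker]
      simp [hs1, hs2, hfp]
    obtain ⟨e, he⟩ := this
    refine ⟨p₀ + e, ?_⟩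
    rw [hslack, add_sub_cancel_left, he, sub_sub_cancel]

/-- A point is a vertex if and only if it is determined by the facets that contain it. -/
theorem mem_extremePoints_body_iff {p : EuclideanSpace ℝ (Fin d)} (hp : p ∈ P.body) :
    p ∈ Set.extremePoints ℝ P.body ↔
      ∀ q ∈ P.body, (∀ h, P.slack p h = 0 → P.slack q h = 0) → q = p := by
  constructor
  · intro hext q hq hsupp
    -- If `q` lies on all facets through `p`, the segment from `q` to `p` extends slightly beyond
    -- `p`, so an extreme `p` must equal `q`.
    have hev : ∀ᶠ t : ℝ in nhdsWithin 0 (Set.Ioi 0), ∀ h, 0 ≤ P.slack (p + t • (p - q)) h := by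
      rw [Filter.eventually_all]
      intro h
      by_cases h0 : P.slack p h = 0
      · refine Filter.Eventually.of_forall fun t => ?_
        rw [slack_add_smul_sub, h0, hsupp h h0]; simp
      · have hpos : 0 < P.slack p h := lt_of_le_of_ne (P.mem_body_iff.1 hp h) (Ne.symm h0)
        have hc : Continuous fun t : ℝ => (1 + t) * P.slack p h - t * P.slack q h := by fun_prop
        have := (hc.tendsto 0).eventually (lt_mem_nhds (a := 0) (by simpa using hpos))
        refine (this.filter_mono nhdsWithin_le_nhds).mono fun t ht => ?_
        rw [slack_add_smul_sub]; exact ht.le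
    obtain ⟨t, ht, ht0⟩ := (hev.and self_mem_nhdsWithin).exists
    have ht0 : (0 : ℝ) < t := ht0
    refine (mem_extremePoints_iff_left.1 hext).2 q hq _ (P.mem_body_iff.2 ht) ?_
    refine ⟨t / (1 + t), 1 / (1 + t), by positivity, by positivity, by field_simp; ring, ?_⟩
    rw [smul_add, smul_smul, smul_sub, ← add_assoc]
    ext i
    simp
    field_simp
    ring
  · intro huniq
    rw [mem_extremePoints_iff_left]
    refine ⟨hp, fun q hq r hr hpqr => huniq q hq fun h h0 => ?_⟩
    obtain ⟨a, b, ha, hb, hab, rfl⟩ := hpqr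
    rw [P.slack_combination hab] at h0
    have h1 := mul_nonneg ha.le (P.mem_body_iff.1 hq h)
    have h2 := mul_nonneg hb.le (P.mem_body_iff.1 hr h)
    have h3 : a * P.slack q h = 0 := by linarith
    exact (mul_eq_zero.1 h3).resolve_left ha.ne'

theorem label_injective : Function.Injective P.label := by
  intro v w hvw
  refine Subtype.ext ?_
  refine (P.mem_extremePoints_body_iff (extremePoints_subset w.2)).1 w.2 v.1
    (extremePoints_subset v.2) fun h h0 => ?_
  rw [← notMem_label_iff, hvw, notMem_label_iff]
  exact h0

instance : Finite P.Vertex := Finite.of_injective _ P.label_injective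

/-- The set of points of the body that lie on all facets in `S`. -/
def face (S : Finset (Fin n)) : Set (EuclideanSpace ℝ (Fin d)) :=
  {p | p ∈ P.body ∧ ∀ h ∈ S, P.slack p h = 0}

theorem isExposed_face (S : Finset (Fin n)) : IsExposed ℝ P.body (P.face S) := by
  rintro ⟨p₀, hp₀, hS₀⟩
  -- The sum of the normals in `S` is maximal exactly where all slacks in `S` vanish, given that
  -- such a point exists.
  refine ⟨∑ h ∈ S, innerSL ℝ (P.normal h), ?_⟩
  have hl : ∀ p, (∑ h ∈ S, innerSL ℝ (P.normal h)) p =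
      ∑ h ∈ S, P.offset h - ∑ h ∈ S, P.slack p h := by
    intro p
    rw [← Finset.sum_sub_distrib]
    simp [slack]
  ext p
  simp only [face, Set.mem_ofPred_eq, hl]
  refine and_congr_right fun hp => ⟨fun h q hq => ?_, fun h => ?_⟩
  · rw [Finset.sum_eq_zero h]
    have := Finset.sum_nonneg (s := S) fun h _ => P.mem_body_iff.1 hq h
    linarith
  · have h1 := h p₀ hp₀
    rw [Finset.sum_eq_zero hS₀] at h1
    have h2 := Finset.sum_nonneg (s := S) fun h _ => P.mem_body_iff.1 hp h
    exact (Finset.sum_eq_zero_iff_of_nonneg fun h _ => P.mem_body_iff.1 hp h).1 (by linarith)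

theorem mem_face_iff {S : Finset (Fin n)} {v : P.Vertex} :
    v.1 ∈ P.face S ↔ ∀ h ∈ S, h ∉ P.label v := by
  simp only [notMem_label_iff]
  exact ⟨fun h => h.2, fun h => ⟨extremePoints_subset v.2, h⟩⟩

/-- Two vertices are adjacent if they are the only vertices of some face. -/
theorem adj_of_face {u v : P.Vertex} (huv : u ≠ v) (S : Finset (Fin n))
    (hS : ∀ w : P.Vertex, w.1 ∈ P.face S ↔ w = u ∨ w = v) : P.Adj u v := by
  refine ⟨huv, ?_⟩
  have hexp := P.isExposed_face S
  have hcomp : IsCompact (P.face S) := hexp.isCompact P.isCompact_body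
  have hconv : Convex ℝ (P.face S) := hexp.convex P.convex_body
  have hu := (hS u).2 (Or.inl rfl)
  have hv := (hS v).2 (Or.inr rfl)
  have heq : P.face S = segment ℝ u.1 v.1 := by
    refine Set.Subset.antisymm ?_ (hconv.segment_subset hu hv)
    rw [← closure_convexHull_extremePoints hcomp hconv]
    refine closure_minimal (convexHull_min ?_ (convex_segment _ _)) ?_
    · intro p hp
      have hp' := hexp.isExtreme.extremePoints_subset_extremePoints hp
      rcases (hS ⟨p, hp'⟩).1 (extremePoints_subset hp) with h | h
      · have : p = u.1 := congrArg Subtype.val h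
        rw [this]; exact left_mem_segment _ _ _
      · have : p = v.1 := congrArg Subtype.val h
        rw [this]; exact right_mem_segment _ _ _
    · rw [← convexHull_pair]
      exact (Set.toFinite _).isClosed_convexHull (𝕜 := ℝ)
  rw [← heq]
  exact hexp

/-- Every facet contains a vertex. -/
theorem exists_notMem_label (h : Fin n) : ∃ v : P.Vertex, h ∉ P.label v := by
  have hexp := P.isExposed_face {h}
  have hne : (P.face {h}).Nonempty := by
    obtain ⟨p, hp, hph⟩ := P.facet_nonempty h
    exact ⟨p, hp, by simp [slack, hph]⟩
  obtain ⟨p, hp⟩ := (hexp.isCompact P.isCompact_body).extremePoints_nonempty hne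
  refine ⟨⟨p, hexp.isExtreme.extremePoints_subset_extremePoints hp⟩, ?_⟩
  rw [notMem_label_iff]
  exact (extremePoints_subset hp).2 h (by simp)

end FacetPolytope
-- The partition by the signs of `mu`
namespace FacetPolytope

variable {d n : ℕ} {P : FacetPolytope d n}

theorem IsSimple.ncard_label (hP : P.IsSimple) (hn : n = d + 2) (v : P.Vertex) :
    (P.label v).ncard = 2 := by
  have h1 := hP v
  have h2 : {h | inner ℝ (P.normal h) v.1 = P.offset h} = (P.label v)ᶜ := by
    ext h
    rw [Set.mem_compl_iff, notMem_label_iff, slack, sub_eq_zero, eq_comm]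
    rfl
  have h3 := Set.ncard_add_ncard_compl (P.label v)
  rw [h2] at h1
  rw [h1, Nat.card_eq_fintype_card, Fintype.card_fin] at h3
  omega

namespace IsSlackSystem

variable {lam mu : Fin n → ℝ} {c : ℝ}

theorem exists_vertex (hs : P.IsSlackSystem lam mu c) (s : Fin n → ℝ) (h0 : ∀ h, 0 ≤ s h)
    (hlam : ∑ h, lam h * s h = c) (hmu : ∑ h, mu h * s h = 0)
    (huniq : ∀ t : Fin n → ℝ, (∀ h, s h = 0 → t h = 0) → ∑ h, lam h * t h = c →
      ∑ h, mu h * t h = 0 → t = s) : ∃ v : P.Vertex, P.slack v.1 = s := by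
  obtain ⟨p, rfl⟩ := hs.exists_slack s hlam hmu
  have hp := P.mem_body_iff.2 h0
  refine ⟨⟨p, (P.mem_extremePoints_body_iff hp).2 fun q _ hq => P.slack_injective ?_⟩, rfl⟩
  exact huniq _ hq (hs.sum_lam q) (hs.sum_mu q)

/-- If `mu h = 0`, the slack vector supported on `h` alone would be a vertex, with a label of size
one instead of two. -/
theorem mu_ne_zero (hs : P.IsSlackSystem lam mu c) (hP : P.IsSimple) (hn : n = d + 2)
    (h : Fin n) : mu h ≠ 0 := by
  intro hmu
  have hl := (hs.lam_pos h).ne'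
  obtain ⟨v, hv⟩ : ∃ v : P.Vertex, P.slack v.1 = Pi.single h (c / lam h) := by
    refine hs.exists_vertex _ ?_ ?_ ?_ ?_
    · intro h'
      exact (Pi.single_nonneg.2 (div_pos hs.pos (hs.lam_pos h)).le : (0 : Fin n → ℝ) ≤ _) h'
    · rw [Fintype.sum_eq_single h fun h' hne => by simp [hne], Pi.single_eq_same]
      field_simp
    · rw [Fintype.sum_eq_single h fun h' hne => by simp [hne], hmu, zero_mul]
    · intro t ht ht1 _
      have h0 : ∀ h', h' ≠ h → t h' = 0 := fun h' hne => ht h' (by simp [hne])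
      rw [Fintype.sum_eq_single h fun h' hne => by simp [h0 h' hne]] at ht1
      ext h'
      by_cases he : h' = h
      · subst he
        rw [Pi.single_eq_same, ← ht1]
        field_simp
      · simp [he, h0 h' he]
  have hlab : P.label v = {h} := by
    ext h'
    rw [mem_label_iff, hv, Set.mem_singleton_iff]
    by_cases he : h' = h
    · subst he
      simpa using div_pos hs.pos (hs.lam_pos _)
    · simp [he]
  have := hP.ncard_label hn v
  rw [hlab, Set.ncard_singleton] at this
  omega

/-- On the support `{x, y}` the two equations form a linear system with positive determinant, by the
opposite signs, and its unique solution is positive. -/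
theorem exists_vertex_label_eq_pair (hs : P.IsSlackSystem lam mu c) {x y : Fin n}
    (hx : 0 < mu x) (hy : mu y < 0) : ∃ v : P.Vertex, P.label v = {x, y} := by
  have hxy : x ≠ y := fun h => (h ▸ hx).not_gt hy
  have hD : 0 < lam x * (-mu y) + lam y * mu x :=
    add_pos (mul_pos (hs.lam_pos x) (neg_pos.2 hy)) (mul_pos (hs.lam_pos y) hx)
  obtain ⟨k, hk⟩ : ∃ k, k = c / (lam x * (-mu y) + lam y * mu x) := ⟨_, rfl⟩
  have hk0 : 0 < k := hk ▸ div_pos hs.pos hD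
  have hkD : k * (lam x * (-mu y) + lam y * mu x) = c := by
    rw [hk, div_mul_cancel₀ _ hD.ne']
  have hsum : ∀ (a t : Fin n → ℝ), (∀ h, h ≠ x ∧ h ≠ y → t h = 0) →
      ∑ h, a h * t h = a x * t x + a y * t y := by
    intro a t ht
    exact Fintype.sum_eq_add x y hxy fun h hh => by rw [ht h hh, mul_zero]
  obtain ⟨s, hsdef⟩ : ∃ s : Fin n → ℝ, s = Pi.single x (k * (-mu y)) + Pi.single y (k * mu x) :=
    ⟨_, rfl⟩
  have hsx : s x = k * (-mu y) := by rw [hsdef]; simp [hxy]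
  have hsy : s y = k * mu x := by rw [hsdef]; simp [hxy.symm]
  have hs0 : ∀ h, h ≠ x ∧ h ≠ y → s h = 0 := fun h hh => by rw [hsdef]; simp [hh.1, hh.2]
  have hsxp : 0 < s x := by rw [hsx]; exact mul_pos hk0 (neg_pos.2 hy)
  have hsyp : 0 < s y := by rw [hsy]; exact mul_pos hk0 hx
  obtain ⟨v, hv⟩ : ∃ v : P.Vertex, P.slack v.1 = s := by
    refine hs.exists_vertex s ?_ ?_ ?_ ?_
    · intro h
      by_cases h1 : h = x
      · rw [h1]; exact hsxp.le
      by_cases h2 : h = y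
      · rw [h2]; exact hsyp.le
      · exact (hs0 h ⟨h1, h2⟩).ge
    · rw [hsum _ _ hs0, hsx, hsy, ← hkD]; ring
    · rw [hsum _ _ hs0, hsx, hsy]; ring
    · intro t ht ht1 ht2
      have ht0 : ∀ h, h ≠ x ∧ h ≠ y → t h = 0 := fun h hh => ht h (hs0 h hh)
      rw [hsum _ _ ht0] at ht1 ht2
      have e1 : t x = s x := by
        refine mul_left_cancel₀ hD.ne' ?_
        rw [hsx]
        linear_combination (-mu y) * ht1 + lam y * ht2 + mu y * hkD
      have e2 : t y = s y := by
        refine mul_left_cancel₀ hD.ne' ?_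
        rw [hsy]
        linear_combination mu x * ht1 - lam x * ht2 - mu x * hkD
      ext h
      by_cases h1 : h = x
      · rw [h1, e1]
      by_cases h2 : h = y
      · rw [h2, e2]
      · rw [ht0 h ⟨h1, h2⟩, hs0 h ⟨h1, h2⟩]
  refine ⟨v, ?_⟩
  ext h
  rw [mem_label_iff, hv, Set.mem_insert_iff, Set.mem_singleton_iff]
  constructor
  · intro hpos
    by_contra hcon
    rw [hs0 h (not_or.1 hcon)] at hpos
    exact lt_irrefl _ hpos
  · rintro (rfl | rfl)
    · exact hsxp
    · exact hsyp

theorem slack_eq_zero_of_label {v : P.Vertex} {x y : Fin n} (hv : P.label v = {x, y})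
    {h : Fin n} (hh : h ≠ x ∧ h ≠ y) : P.slack v.1 h = 0 := by
  rw [← notMem_label_iff, hv]
  simp [hh.1, hh.2]

theorem mu_mul_slack_add (hs : P.IsSlackSystem lam mu c) {v : P.Vertex} {x y : Fin n}
    (hxy : x ≠ y) (hv : P.label v = {x, y}) :
    mu x * P.slack v.1 x + mu y * P.slack v.1 y = 0 := by
  have h := hs.sum_mu v.1
  rwa [Fintype.sum_eq_add x y hxy
    fun h hh => by rw [slack_eq_zero_of_label hv hh, mul_zero]] at h

theorem slack_pos_of_label {v : P.Vertex} {x y : Fin n} (hv : P.label v = {x, y}) :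
    0 < P.slack v.1 x ∧ 0 < P.slack v.1 y := by
  rw [← mem_label_iff, ← mem_label_iff, hv]
  simp

theorem mu_mul_neg (hs : P.IsSlackSystem lam mu c) (hmu : ∀ h, mu h ≠ 0) {v : P.Vertex}
    {x y : Fin n} (hxy : x ≠ y) (hv : P.label v = {x, y}) : mu x * mu y < 0 := by
  have h1 := hs.mu_mul_slack_add hxy hv
  obtain ⟨h2, h3⟩ := slack_pos_of_label hv
  have h4 : mu x * mu y * P.slack v.1 y = -(mu x ^ 2 * P.slack v.1 x) := by
    linear_combination mu x * h1
  have h5 : 0 < mu x ^ 2 * P.slack v.1 x := mul_pos (by have := hmu x; positivity) h2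
  by_contra hcon
  have := mul_nonneg (not_lt.1 hcon) h3.le
  linarith

/-- Scaled this way, the slack vector splits into a term in `x` minus a term in `y`, so the two
diagonals of a quadrilateral have equal sums. -/
theorem slack_eq_of_label (hs : P.IsSlackSystem lam mu c) (hmu : ∀ h, mu h ≠ 0) {v : P.Vertex}
    {x y : Fin n} (hxy : x ≠ y) (hv : P.label v = {x, y}) (h : Fin n) :
    (P.slack v.1 x * mu x)⁻¹ * P.slack v.1 h =
      (Pi.single x (mu x)⁻¹ : Fin n → ℝ) h - (Pi.single y (mu y)⁻¹ : Fin n → ℝ) h := by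
  have h1 := hs.mu_mul_slack_add hxy hv
  have h2 := (slack_pos_of_label hv).1.ne'
  have hx := hmu x
  have hy := hmu y
  by_cases e1 : h = x
  · subst e1
    simp [hxy]
    field_simp
  by_cases e2 : h = y
  · subst e2
    simp [hxy.symm]
    field_simp
    linear_combination h1
  · simp [e1, e2, slack_eq_zero_of_label hv ⟨e1, e2⟩]

/-- The diagonals of a quadrilateral face are not edges. -/
theorem not_adj_of_label (hs : P.IsSlackSystem lam mu c) (hmu : ∀ h, mu h ≠ 0)
    {v w u u' : P.Vertex} {x y x' y' : Fin n} (hv : P.label v = {x, y})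
    (hw : P.label w = {x', y'}) (hu : P.label u = {x, y'}) (hu' : P.label u' = {x', y})
    (hxy : x ≠ y) (hxy' : x ≠ y') (hx'y : x' ≠ y) (hx'y' : x' ≠ y') (hxx' : x ≠ x')
    (hyy' : y ≠ y') : ¬ P.Adj v w := by
  rintro ⟨_, hexp⟩
  obtain ⟨l, hl⟩ := hexp ⟨v.1, left_mem_segment _ _ _⟩
  have hbody : ∀ z : P.Vertex, z.1 ∈ P.body := fun z => extremePoints_subset z.2
  have hvm : v.1 ∈ segment ℝ v.1 w.1 := left_mem_segment _ _ _
  have hwm : w.1 ∈ segment ℝ v.1 w.1 := right_mem_segment _ _ _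
  rw [hl] at hvm hwm
  have hlvw : l w.1 = l v.1 := le_antisymm (hvm.2 _ (hbody w)) (hwm.2 _ (hbody v))
  obtain ⟨kv, hkv⟩ : ∃ k, k = (P.slack v.1 x * mu x)⁻¹ := ⟨_, rfl⟩
  obtain ⟨kw, hkw⟩ : ∃ k, k = (P.slack w.1 x' * mu x')⁻¹ := ⟨_, rfl⟩
  obtain ⟨ku, hku⟩ : ∃ k, k = (P.slack u.1 x * mu x)⁻¹ := ⟨_, rfl⟩
  obtain ⟨ku', hku'⟩ : ∃ k, k = (P.slack u'.1 x' * mu x')⁻¹ := ⟨_, rfl⟩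
  have hslack : ∀ h, kv * P.slack v.1 h + kw * P.slack w.1 h =
      ku * P.slack u.1 h + ku' * P.slack u'.1 h := by
    intro h
    rw [hkv, hkw, hku, hku', hs.slack_eq_of_label hmu hxy hv, hs.slack_eq_of_label hmu hx'y' hw,
      hs.slack_eq_of_label hmu hxy' hu, hs.slack_eq_of_label hmu hx'y hu']
    ring
  have hk : kv + kw = ku + ku' := by
    refine mul_right_cancel₀ hs.pos.ne' ?_
    have hsum : ∀ (a b : ℝ) (p q : EuclideanSpace ℝ (Fin d)),
        ∑ h, lam h * (a * P.slack p h + b * P.slack q h) = (a + b) * c := by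
      intro a b p q
      rw [add_mul]
      nth_rewrite 1 [← hs.sum_lam p]
      rw [← hs.sum_lam q, Finset.mul_sum, Finset.mul_sum, ← Finset.sum_add_distrib]
      exact Finset.sum_congr rfl fun h _ => by ring
    rw [← hsum kv kw v.1 w.1, ← hsum ku ku' u.1 u'.1]
    simp only [hslack]
  have hpt : kv • v.1 + kw • w.1 - (ku • u.1 + ku' • u'.1) = 0 := by
    refine P.eq_zero_of_forall_inner_eq_zero fun h => ?_
    have := hslack h
    simp only [slack] at this
    simp only [inner_sub_right, inner_add_right, inner_smul_right]
    linear_combination P.offset h * hk - this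
  have hleq := congrArg l hpt
  simp only [map_sub, map_add, map_smul, map_zero, smul_eq_mul, hlvw] at hleq
  -- `mu x` and `mu x'` are both opposite in sign to `mu y`, so `ku` and `ku'` have the same sign. A
  -- functional exposing the diagonal is then maximal at `u` too, which puts the vertex `u` on that
  -- diagonal.
  have hkk : 0 < ku * ku' := by
    rw [hku, hku', ← mul_inv]
    refine inv_pos.2 ?_
    have h1 := hs.mu_mul_neg hmu hxy hv
    have h2 := hs.mu_mul_neg hmu hx'y hu'
    have h3 : 0 < mu x * mu x' := by
      by_contra hcon
      have h4 := mul_pos_of_neg_of_neg h1 h2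
      have h5 : 0 ≤ mu y ^ 2 := sq_nonneg _
      nlinarith
    have := mul_pos (mul_pos (slack_pos_of_label hu).1 (slack_pos_of_label hu').1) h3
    nlinarith
  have hu1 := hvm.2 _ (hbody u)
  have hu1' := hvm.2 _ (hbody u')
  have hlu : l u.1 = l v.1 := by
    have h0 : ku * (l v.1 - l u.1) + ku' * (l v.1 - l u'.1) = 0 := by
      linear_combination hleq - l v.1 * hk
    have h1 : ku ^ 2 * (l v.1 - l u.1) + ku * ku' * (l v.1 - l u'.1) = 0 := by
      linear_combination ku * h0
    have h2 : 0 < ku ^ 2 := by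
      have : ku ≠ 0 := left_ne_zero_of_mul hkk.ne'
      positivity
    have h3 := mul_nonneg hkk.le (sub_nonneg.2 hu1')
    have h4 : ku ^ 2 * (l v.1 - l u.1) ≤ 0 := by linarith
    have h5 := nonpos_of_mul_nonpos_right h4 h2
    linarith
  have humem : u.1 ∈ segment ℝ v.1 w.1 := by
    rw [hl]
    exact ⟨hbody u, fun q hq => by rw [hlu]; exact hvm.2 q hq⟩
  rcases (mem_extremePoints_iff_forall_segment.1 u.2).2 _ (hbody v) _ (hbody w) humem with h | h
  · have h := congrArg P.label (Subtype.ext h : v = u)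
    rw [hv, hu] at h
    have : y ∈ ({x, y'} : Set (Fin n)) := h ▸ (by simp)
    simp [hxy.symm, hyy'] at this
  · have h := congrArg P.label (Subtype.ext h : w = u)
    rw [hw, hu] at h
    have : x' ∈ ({x, y'} : Set (Fin n)) := h ▸ (by simp)
    simp [hxx'.symm, hx'y'] at this

end IsSlackSystem

/-- The vertices of a simple `d`-polytope with `d + 2` facets form a grid. -/
theorem exists_isGridPartition (hP : P.IsSimple) (hn : n = d + 2) :
    ∃ X Y : Set (Fin n), P.IsGridPartition X Y := by
  obtain ⟨lam, mu, c, hs⟩ := P.exists_isSlackSystem hn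
  have hmu := hs.mu_ne_zero hP hn
  refine ⟨{h | 0 < mu h}, {h | mu h < 0}, ?_, ?_, ?_⟩
  · exact Set.disjoint_left.2 fun h h1 h2 => lt_asymm (Set.mem_ofPred_eq ▸ h1) h2
  · ext h
    simpa [or_comm] using lt_or_gt_of_ne (hmu h)
  · ext S
    constructor
    · rintro ⟨v, rfl⟩
      obtain ⟨x, y, hxy, hv⟩ := Set.ncard_eq_two.1 (hP.ncard_label hn v)
      rcases mul_neg_iff.1 (hs.mu_mul_neg hmu hxy hv) with h | h
      · exact ⟨x, h.1, y, h.2, hv⟩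
      · exact ⟨y, h.2, x, h.1, by rw [hv, Set.pair_comm]⟩
    · rintro ⟨x, hx, y, hy, rfl⟩
      exact hs.exists_vertex_label_eq_pair hx hy

theorem IsGridPartition.swap {X Y : Set (Fin n)} (hXY : P.IsGridPartition X Y) :
    P.IsGridPartition Y X where
  disjoint := hXY.disjoint.symm
  union_eq := by rw [Set.union_comm, hXY.union_eq]
  range_label := by
    rw [hXY.range_label]
    ext S
    constructor
    · rintro ⟨x, hx, y, hy, rfl⟩
      exact ⟨y, hy, x, hx, Set.pair_comm _ _⟩
    · rintro ⟨y, hy, x, hx, rfl⟩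
      exact ⟨x, hx, y, hy, Set.pair_comm _ _⟩

/-- Every label meets `X`; if `X` were a single `x`, the facet `x` would contain no vertex. -/
theorem IsGridPartition.two_le_ncard {X Y : Set (Fin n)} (hXY : P.IsGridPartition X Y) :
    2 ≤ X.ncard := by
  have hlab : ∀ v : P.Vertex, ∃ x ∈ X, x ∈ P.label v := by
    intro v
    have : P.label v ∈ Set.range P.label := ⟨v, rfl⟩
    rw [hXY.range_label] at this
    obtain ⟨x, hx, y, _, h⟩ := this
    exact ⟨x, hx, by rw [h]; simp⟩
  obtain ⟨p, hp⟩ := P.isCompact_body.extremePoints_nonempty P.body_nonempty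
  obtain ⟨x, hx, _⟩ := hlab ⟨p, hp⟩
  obtain ⟨v, hv⟩ := P.exists_notMem_label x
  obtain ⟨x', hx', hx'v⟩ := hlab v
  have : 1 < X.ncard := (Set.one_lt_ncard (Set.toFinite X)).2
    ⟨x, hx, x', hx', fun h => hv (h ▸ hx'v)⟩
  omega

end FacetPolytope
-- Grid coordinates and transfer of the walk
namespace FacetPolytope

variable {d n : ℕ} {P : FacetPolytope d n}

namespace IsGridPartition

variable {X Y : Set (Fin n)}

theorem exists_label_eq (hXY : P.IsGridPartition X Y) (p : X × Y) : ∃ v : P.Vertex, P.label v = {p.1.1, p.2.1} := by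
  have : ({p.1.1, p.2.1} : Set (Fin n)) ∈ Set.range P.label := by
    rw [hXY.range_label]
    exact ⟨p.1.1, p.1.2, p.2.1, p.2.2, rfl⟩
  exact this

/-- The vertex of the grid with given coordinates. -/
noncomputable def vertex (hXY : P.IsGridPartition X Y) (p : X × Y) : P.Vertex := (hXY.exists_label_eq p).choose

theorem label_vertex (hXY : P.IsGridPartition X Y) (p : X × Y) : P.label (hXY.vertex p) = {p.1.1, p.2.1} :=
  (hXY.exists_label_eq p).choose_spec

theorem coe_ne_coe (hXY : P.IsGridPartition X Y) (x : X) (y : Y) : x.1 ≠ y.1 := fun h =>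
  Set.disjoint_left.1 hXY.disjoint x.2 (h ▸ y.2)

theorem coe_left_mem_label (hXY : P.IsGridPartition X Y) {p : X × Y} {x : X} : x.1 ∈ P.label (hXY.vertex p) ↔ x = p.1 := by
  rw [label_vertex, Set.mem_insert_iff, Set.mem_singleton_iff, Subtype.ext_iff]
  exact or_iff_left (hXY.coe_ne_coe _ _)

theorem coe_right_mem_label (hXY : P.IsGridPartition X Y) {p : X × Y} {y : Y} : y.1 ∈ P.label (hXY.vertex p) ↔ y = p.2 := by
  rw [label_vertex, Set.mem_insert_iff, Set.mem_singleton_iff, Subtype.ext_iff]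
  exact or_iff_right (hXY.coe_ne_coe _ _).symm

theorem vertex_injective (hXY : P.IsGridPartition X Y) : Function.Injective hXY.vertex := by
  intro p p' h
  refine Prod.ext ?_ ?_
  · rw [← hXY.coe_left_mem_label, ← h, hXY.coe_left_mem_label]
  · rw [← hXY.coe_right_mem_label, ← h, hXY.coe_right_mem_label]

theorem vertex_surjective (hXY : P.IsGridPartition X Y) : Function.Surjective hXY.vertex := by
  intro v
  have : P.label v ∈ Set.range P.label := ⟨v, rfl⟩
  rw [hXY.range_label] at this
  obtain ⟨x, hx, y, hy, h⟩ := this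
  exact ⟨(⟨x, hx⟩, ⟨y, hy⟩), P.label_injective (by rw [h, label_vertex])⟩

open Classical in
/-- Subgrids are the vertex sets of faces. -/
theorem exists_face_iff (hXY : P.IsGridPartition X Y) (S : Finset X) (T : Finset Y) :
    ∃ F : Finset (Fin n), ∀ p, (hXY.vertex p).1 ∈ P.face F ↔ p.1 ∈ S ∧ p.2 ∈ T := by
  -- The face lies on all facets outside `S` and `T`, so exactly the labels inside their union
  -- survive.
  refine ⟨Finset.univ.filter fun h => (∀ x ∈ S, h ≠ x.1) ∧ ∀ y ∈ T, h ≠ y.1, fun p => ?_⟩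
  rw [mem_face_iff]
  simp only [Finset.mem_filter, Finset.mem_univ, true_and]
  constructor
  · intro h
    constructor
    · by_contra hp
      refine h p.1.1 ⟨fun x hx he => hp ?_, fun y _ => hXY.coe_ne_coe _ _⟩
        (hXY.coe_left_mem_label.2 rfl)
      rwa [Subtype.ext he]
    · by_contra hp
      refine h p.2.1 ⟨fun x _ => (hXY.coe_ne_coe _ _).symm, fun y hy he => hp ?_⟩
        (hXY.coe_right_mem_label.2 rfl)
      rwa [Subtype.ext he]
  · rintro ⟨h1, h2⟩ h ⟨h3, h4⟩ hmem
    rw [label_vertex] at hmem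
    rcases hmem with rfl | rfl
    · exact h3 _ h1 rfl
    · exact h4 _ h2 rfl

theorem adj_left (hXY : P.IsGridPartition X Y) {x x' : X} (hne : x ≠ x') (y : Y) :
    P.Adj (hXY.vertex (x, y)) (hXY.vertex (x', y)) := by
  classical
  obtain ⟨F, hF⟩ := hXY.exists_face_iff {x, x'} {y}
  refine P.adj_of_face (fun h => hne (Prod.mk.inj (hXY.vertex_injective h)).1) F fun w => ?_
  obtain ⟨p, rfl⟩ := hXY.vertex_surjective w
  rw [hF, hXY.vertex_injective.eq_iff, hXY.vertex_injective.eq_iff]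
  simp only [Finset.mem_insert, Finset.mem_singleton, Prod.ext_iff]
  tauto

theorem adj_right (hXY : P.IsGridPartition X Y) (x : X) {y y' : Y} (hne : y ≠ y') :
    P.Adj (hXY.vertex (x, y)) (hXY.vertex (x, y')) := by
  classical
  obtain ⟨F, hF⟩ := hXY.exists_face_iff {x} {y, y'}
  refine P.adj_of_face (fun h => hne (Prod.mk.inj (hXY.vertex_injective h)).2) F fun w => ?_
  obtain ⟨p, rfl⟩ := hXY.vertex_surjective w
  rw [hF, hXY.vertex_injective.eq_iff, hXY.vertex_injective.eq_iff]
  simp only [Finset.mem_insert, Finset.mem_singleton, Prod.ext_iff]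
  tauto

theorem eq_or_eq_of_adj (hXY : P.IsGridPartition X Y) (hP : P.IsSimple) (hn : n = d + 2) {p p' : X × Y}
    (h : P.Adj (hXY.vertex p) (hXY.vertex p')) : p.1 = p'.1 ∨ p.2 = p'.2 := by
  by_contra hcon
  rw [not_or] at hcon
  obtain ⟨lam, mu, c, hs⟩ := P.exists_isSlackSystem hn
  exact hs.not_adj_of_label (hs.mu_ne_zero hP hn) (hXY.label_vertex p) (hXY.label_vertex p')
    (hXY.label_vertex (p.1, p'.2)) (hXY.label_vertex (p'.1, p.2)) (hXY.coe_ne_coe _ _)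
    (hXY.coe_ne_coe _ _) (hXY.coe_ne_coe _ _) (hXY.coe_ne_coe _ _)
    (fun he => hcon.1 (Subtype.ext he)) (fun he => hcon.2 (Subtype.ext he)) h

/-- The grid orientation that is induced by a unique sink orientation of the polytope. -/
def gridUSO (hXY : P.IsGridPartition X Y) (hP : P.IsSimple) (hn : n = d + 2) (O : P.Orientation) (hO : O.IsUniqueSink) :
    GridUSO X Y where
  H y x x' := O.arrow (hXY.vertex (x, y)) (hXY.vertex (x', y))
  V x y y' := O.arrow (hXY.vertex (x, y)) (hXY.vertex (x, y'))
  H_asymm y x x' := O.asymm _ _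
  V_asymm x y y' := O.asymm _ _
  H_total y x x' hne := O.arrow_or_arrow _ _ (hXY.adj_left hne y)
  V_total x y y' hne := O.arrow_or_arrow _ _ (hXY.adj_right x hne)
  unique_sink S T hS hT := by
    obtain ⟨F, hF⟩ := hXY.exists_face_iff S T
    obtain ⟨x, hx⟩ := hS
    obtain ⟨y, hy⟩ := hT
    obtain ⟨v, ⟨hvF, hv⟩, hu⟩ := hO _ (P.isExposed_face F) ⟨_, (hF (x, y)).2 ⟨hx, hy⟩⟩
    obtain ⟨p, rfl⟩ := hXY.vertex_surjective v
    have hp := (hF p).1 hvF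
    refine ⟨p, ⟨hp, fun x' hx' => hv _ ((hF (x', p.2)).2 ⟨hx', hp.2⟩),
      fun y' hy' => hv _ ((hF (p.1, y')).2 ⟨hp.1, hy'⟩)⟩, ?_⟩
    rintro p' ⟨hp', h1, h2⟩
    refine hXY.vertex_injective (hu _ ⟨(hF p').2 hp', fun w hw ha => ?_⟩)
    obtain ⟨q, rfl⟩ := hXY.vertex_surjective w
    have hq := (hF q).1 hw
    obtain ⟨a, b⟩ := q
    obtain ⟨a', b'⟩ := p'
    rcases hXY.eq_or_eq_of_adj hP hn (O.adj_of_arrow _ _ ha) with he | he <;> dsimp only at he <;>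
      subst he
    · exact h2 b hq.2 ha
    · exact h1 a hq.1 ha

theorem arrow_vertex_iff (hXY : P.IsGridPartition X Y) (hP : P.IsSimple)
    (hn : n = d + 2) (O : P.Orientation) (hO : O.IsUniqueSink) {p : X × Y} {w : P.Vertex} : O.arrow (hXY.vertex p) w ↔
    (∃ x, (hXY.gridUSO hP hn O hO).H p.2 p.1 x ∧ hXY.vertex (x, p.2) = w) ∨
      ∃ y, (hXY.gridUSO hP hn O hO).V p.1 p.2 y ∧ hXY.vertex (p.1, y) = w := by
  constructor
  · intro ha
    obtain ⟨q, rfl⟩ := hXY.vertex_surjective w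
    obtain ⟨a, b⟩ := q
    obtain ⟨a', b'⟩ := p
    rcases hXY.eq_or_eq_of_adj hP hn (O.adj_of_arrow _ _ ha) with he | he <;> dsimp only at he <;>
      subst he
    · exact Or.inr ⟨b, ha, rfl⟩
    · exact Or.inl ⟨a, ha, rfl⟩
  · rintro (⟨x, h, rfl⟩ | ⟨y, h, rfl⟩)
    · exact h
    · exact h

noncomputable instance : Fintype X := Fintype.ofFinite X

theorem outmap_vertex_inter_left (hXY : P.IsGridPartition X Y) (hP : P.IsSimple)
    (hn : n = d + 2) (O : P.Orientation) (hO : O.IsUniqueSink) (p : X × Y) :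
    O.outmap (hXY.vertex p) ∩ X = Subtype.val '' ((hXY.gridUSO hP hn O hO).hOut p : Set X) := by
  ext h
  simp only [Orientation.outmap, Set.mem_inter_iff, Set.mem_ofPred_eq, Set.mem_image,
    Finset.mem_coe, GridUSO.mem_hOut]
  constructor
  · rintro ⟨⟨h1, w, hw, h2⟩, hX⟩
    lift h to X using hX
    refine ⟨h, ?_, rfl⟩
    rcases (hXY.arrow_vertex_iff hP hn O hO).1 hw with ⟨x, hx, rfl⟩ | ⟨y, _, rfl⟩
    · rw [hXY.coe_left_mem_label] at h2
      rwa [h2]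
    · rw [hXY.coe_left_mem_label] at h1 h2
      exact absurd h2 h1
  · rintro ⟨x, hx, rfl⟩
    refine ⟨⟨?_, _, (hXY.arrow_vertex_iff hP hn O hO).2 (Or.inl ⟨x, hx, rfl⟩),
      hXY.coe_left_mem_label.2 rfl⟩, x.2⟩
    rw [hXY.coe_left_mem_label]
    rintro rfl
    exact GridUSO.H_irrefl _ _ _ hx

theorem outmap_vertex_inter_right (hXY : P.IsGridPartition X Y) (hP : P.IsSimple)
    (hn : n = d + 2) (O : P.Orientation) (hO : O.IsUniqueSink) (p : X × Y) :
    O.outmap (hXY.vertex p) ∩ Y = Subtype.val '' ((hXY.gridUSO hP hn O hO).vOut p : Set Y) := by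
  ext h
  simp only [Orientation.outmap, Set.mem_inter_iff, Set.mem_ofPred_eq, Set.mem_image,
    Finset.mem_coe, GridUSO.mem_vOut]
  constructor
  · rintro ⟨⟨h1, w, hw, h2⟩, hY⟩
    lift h to Y using hY
    refine ⟨h, ?_, rfl⟩
    rcases (hXY.arrow_vertex_iff hP hn O hO).1 hw with ⟨x, _, rfl⟩ | ⟨y, hy, rfl⟩
    · rw [hXY.coe_right_mem_label] at h1 h2
      exact absurd h2 h1
    · rw [hXY.coe_right_mem_label] at h2
      rwa [h2]
  · rintro ⟨y, hy, rfl⟩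
    refine ⟨⟨?_, _, (hXY.arrow_vertex_iff hP hn O hO).2 (Or.inr ⟨y, hy, rfl⟩),
      hXY.coe_right_mem_label.2 rfl⟩, y.2⟩
    rw [hXY.coe_right_mem_label]
    rintro rfl
    exact GridUSO.V_irrefl _ _ _ hy

theorem refinedOutdegree_vertex (hXY : P.IsGridPartition X Y) (hP : P.IsSimple)
    (hn : n = d + 2) (O : P.Orientation) (hO : O.IsUniqueSink) (p : X × Y) : O.refinedOutdegree X Y (hXY.vertex p) =
    (((hXY.gridUSO hP hn O hO).hOut p).card, ((hXY.gridUSO hP hn O hO).vOut p).card) := by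
  rw [Orientation.refinedOutdegree, hXY.outmap_vertex_inter_left hP hn O hO,
    hXY.outmap_vertex_inter_right hP hn O hO,
    Set.ncard_image_of_injective _ Subtype.val_injective,
    Set.ncard_image_of_injective _ Subtype.val_injective, Set.ncard_coe_finset,
    Set.ncard_coe_finset]

theorem isSuccClosed_reachable (hXY : P.IsGridPartition X Y) (hP : P.IsSimple)
    (hn : n = d + 2) (O : P.Orientation) (hO : O.IsUniqueSink) (p : X × Y) : (hXY.gridUSO hP hn O hO).IsSuccClosed p
    {q | hXY.vertex q ∈ O.reachable (hXY.vertex p)} where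
  base_H _ hx := Relation.TransGen.single hx
  base_V _ hy := Relation.TransGen.single hy
  step_H _ hv _ hx := Relation.TransGen.tail hv hx
  step_V _ hv _ hy := Relation.TransGen.tail hv hy

open Classical in
/-- The transition operator of the directed random walk in grid coordinates. -/
theorem finsum_stepProb_mul (hXY : P.IsGridPartition X Y) (hP : P.IsSimple)
    (hn : n = d + 2) (O : P.Orientation) (hO : O.IsUniqueSink) (p : X × Y) (g : P.Vertex → ℝ) (hg : ∀ v, 0 ≤ g v)
    (hpos : 0 < ((hXY.gridUSO hP hn O hO).hOut p).card +
      ((hXY.gridUSO hP hn O hO).vOut p).card) :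
    ∑ᶠ w, O.stepProb (hXY.vertex p) w * ENNReal.ofReal (g w) =
      ENNReal.ofReal ((∑ x ∈ (hXY.gridUSO hP hn O hO).hOut p, g (hXY.vertex (x, p.2)) +
        ∑ y ∈ (hXY.gridUSO hP hn O hO).vOut p, g (hXY.vertex (p.1, y))) /
        (((hXY.gridUSO hP hn O hO).hOut p).card +
          ((hXY.gridUSO hP hn O hO).vOut p).card : ℕ)) := by
  obtain ⟨G, hG⟩ : ∃ G, G = hXY.gridUSO hP hn O hO := ⟨_, rfl⟩
  have harrow := fun w => hXY.arrow_vertex_iff hP hn O hO (p := p) (w := w)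
  rw [← hG] at hpos ⊢
  simp only [← hG] at harrow
  have hiH : Function.Injective fun x => hXY.vertex (x, p.2) := fun x x' h =>
    (Prod.mk.inj (hXY.vertex_injective h)).1
  have hiV : Function.Injective fun y => hXY.vertex (p.1, y) := fun x x' h =>
    (Prod.mk.inj (hXY.vertex_injective h)).2
  obtain ⟨U, hU⟩ : ∃ U : Finset P.Vertex, U = (G.hOut p).image (fun x => hXY.vertex (x, p.2)) ∪
    (G.vOut p).image (fun y => hXY.vertex (p.1, y)) := ⟨_, rfl⟩
  have hmemU : ∀ w, w ∈ U ↔ O.arrow (hXY.vertex p) w := by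
    intro w
    rw [hU, harrow]
    simp
  have hdisj : Disjoint ((G.hOut p).image (fun x => hXY.vertex (x, p.2)))
      ((G.vOut p).image (fun y => hXY.vertex (p.1, y))) := by
    rw [Finset.disjoint_left]
    intro w h1 h2
    obtain ⟨x, hx, rfl⟩ := Finset.mem_image.1 h1
    obtain ⟨y, hy, he⟩ := Finset.mem_image.1 h2
    have := (Prod.mk.inj (hXY.vertex_injective he)).1
    rw [GridUSO.mem_hOut, ← this] at hx
    exact G.H_irrefl _ _ hx
  have hcard : U.card = (G.hOut p).card + (G.vOut p).card := by
    rw [hU, Finset.card_union_of_disjoint hdisj, Finset.card_image_of_injective _ hiH,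
      Finset.card_image_of_injective _ hiV]
  have hset : {z | O.arrow (hXY.vertex p) z} = U := by
    ext z; simp [hmemU]
  have hex : ∃ z, O.arrow (hXY.vertex p) z := by
    obtain ⟨z, hz⟩ := Finset.card_pos.1 (hcard ▸ hpos)
    exact ⟨z, (hmemU z).1 hz⟩
  have hstep : ∀ w, O.stepProb (hXY.vertex p) w =
      if w ∈ U then ((U.card : ℕ) : ℝ≥0∞)⁻¹ else 0 := by
    intro w
    simp only [Orientation.stepProb]
    rw [if_pos hex, hset, Set.ncard_coe_finset]
    simp only [hmemU]
  have hpR : (0 : ℝ) < (U.card : ℕ) := by rw [hcard]; exact_mod_cast hpos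
  rw [finsum_eq_sum_of_support_subset (s := U)]
  · rw [← hcard, ENNReal.ofReal_div_of_pos hpR, ENNReal.ofReal_natCast, div_eq_mul_inv,
      mul_comm]
    have hs : ∑ x ∈ G.hOut p, g (hXY.vertex (x, p.2)) +
        ∑ y ∈ G.vOut p, g (hXY.vertex (p.1, y)) = ∑ w ∈ U, g w := by
      rw [hU, Finset.sum_union hdisj, Finset.sum_image fun x _ x' _ h => hiH h,
        Finset.sum_image fun y _ y' _ h => hiV h]
    rw [hs, ENNReal.ofReal_sum_of_nonneg fun w _ => hg w, Finset.mul_sum]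
    exact Finset.sum_congr rfl fun w hw => by rw [hstep, if_pos hw]
  · intro w hw
    by_contra hn
    refine hw ?_
    dsimp only
    rw [hstep, if_neg (by simpa using hn), zero_mul]

/-- The expected time to reach the successors of the vertex with refined outdegree `(q, q)`. -/
theorem lintegral_firstHit_reachable_le (hXY : P.IsGridPartition X Y) (hP : P.IsSimple)
    (hn : n = d + 2) (O : P.Orientation) (hO : O.IsUniqueSink) {q : ℕ} (hq : 0 < q) (hXq : X.ncard ≤ 2 * q)
    {w : P.Vertex} (hw : O.refinedOutdegree X Y w = (q, q)) {Ω : Type*} [MeasurableSpace Ω]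
    (μ : Measure Ω) [IsProbabilityMeasure μ] {v₀ : P.Vertex} {v : ℕ → Ω → P.Vertex}
    (hv : O.IsDirectedRandomWalk μ v₀ v) :
    ∫⁻ ω, firstHit (O.reachable w) (fun k => v k ω) ∂μ ≤
      ENNReal.ofReal (36 * (1 + Real.log n) + 9) := by
  obtain ⟨p, rfl⟩ := hXY.vertex_surjective w
  rw [hXY.refinedOutdegree_vertex hP hn O hO, Prod.mk.injEq] at hw
  have hY : Fintype.card Y ≤ n := by
    have := Fintype.card_subtype_le fun h => h ∈ Y
    rw [Fintype.card_fin] at this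
    convert this
  obtain ⟨g, hg0, hgle, hg⟩ := (hXY.isSuccClosed_reachable hP hn O hO p).exists_lyapunov hq
    hw.1 hw.2 (by rwa [← Nat.card_eq_fintype_card, Nat.card_coe_set_eq])
    (h := 1 + Real.log n) fun j hj => by
      refine (harmonic_le_one_add_log j).trans ?_
      rcases Nat.eq_zero_or_pos j with rfl | hj0
      · simpa using Real.log_natCast_nonneg n
      · have : (j : ℝ) ≤ n := by exact_mod_cast hj.le.trans hY
        have := Real.log_le_log (by exact_mod_cast hj0) this
        linarith
  let e := Equiv.ofBijective hXY.vertex ⟨hXY.vertex_injective, hXY.vertex_surjective⟩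
  have he : ∀ p, e.symm (hXY.vertex p) = p := fun p => e.symm_apply_apply p
  refine (lintegral_firstHit_le μ _ v₀ v hv.measurable O.stepProb
    (fun u => ENNReal.ofReal (g (e.symm u))) hv.start hv.step fun u hu => ?_).trans
    (ENNReal.ofReal_le_ofReal (hgle _))
  obtain ⟨r, rfl⟩ := hXY.vertex_surjective u
  obtain ⟨h1, h2⟩ := hg r hu
  rw [hXY.finsum_stepProb_mul hP hn O hO r (fun u => g (e.symm u)) (fun _ => hg0 _) h1,
    ← ENNReal.ofReal_one, ← ENNReal.ofReal_add zero_le_one]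
  · refine ENNReal.ofReal_le_ofReal ?_
    simp only [he]
    have h3 : (0 : ℝ) < (((hXY.gridUSO hP hn O hO).hOut r).card +
      ((hXY.gridUSO hP hn O hO).vOut r).card : ℕ) := by exact_mod_cast h1
    have h4 : (∑ x ∈ (hXY.gridUSO hP hn O hO).hOut r, g (x, r.2) +
        ∑ y ∈ (hXY.gridUSO hP hn O hO).vOut r, g (r.1, y)) /
        (((hXY.gridUSO hP hn O hO).hOut r).card +
          ((hXY.gridUSO hP hn O hO).vOut r).card : ℕ) ≤ g r - 1 := by
      rw [div_le_iff₀ h3]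
      linarith
    linarith
  · exact div_nonneg (add_nonneg (Finset.sum_nonneg fun _ _ => hg0 _)
      (Finset.sum_nonneg fun _ _ => hg0 _)) (Nat.cast_nonneg _)

end IsGridPartition

end FacetPolytope

/-! ### Assembly of the theorem -/

theorem proposition3 :
    ∃ C : ℝ, ∀ (d n : ℕ), n = d + 2 →
      ∀ (P : FacetPolytope d n), P.IsSimple →
      ∀ (O : P.Orientation), O.IsUniqueSink →
        (∃ X Y : Set (Fin n), P.IsGridPartition X Y) ∧
        ∀ X Y : Set (Fin n), P.IsGridPartition X Y →
          2 ≤ X.ncard ∧ 2 ≤ Y.ncard ∧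
          ∃ w : P.Vertex,
            (∀ v : P.Vertex, O.refinedOutdegree X Y v =
              (2 ^ (numMilestones X Y - 1), 2 ^ (numMilestones X Y - 1)) ↔ v = w) ∧
            ∀ (Ω : Type*) [MeasurableSpace Ω] (μ : Measure Ω) [IsProbabilityMeasure μ]
              (v₀ : P.Vertex) (v : ℕ → Ω → P.Vertex), O.IsDirectedRandomWalk μ v₀ v →
              ∫⁻ ω, firstHit (O.reachable w) (fun k => v k ω) ∂μ ≤
                ENNReal.ofReal (C * Real.log n) := by
  -- From `36 * (1 + log n) + 9 = 36 * log n + 45` and `log n ≥ 1`.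
  refine ⟨81, fun d n hn P hP O hO => ⟨FacetPolytope.exists_isGridPartition hP hn,
    fun X Y hXY => ?_⟩⟩
  have hX := hXY.two_le_ncard
  have hY := hXY.swap.two_le_ncard
  refine ⟨hX, hY, ?_⟩
  have hcX : Fintype.card X = X.ncard := by
    rw [← Nat.card_eq_fintype_card, Nat.card_coe_set_eq]
  have hcY : Fintype.card Y = Y.ncard := by
    rw [← Nat.card_eq_fintype_card, Nat.card_coe_set_eq]
  obtain ⟨q, hq⟩ : ∃ q, q = 2 ^ (numMilestones X Y - 1) := ⟨_, rfl⟩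
  have hq' : q = 2 ^ Nat.log 2 (min (X.ncard - 1) (Y.ncard - 1)) := by
    rw [hq, numMilestones, Nat.add_sub_cancel_left]
  have hq0 : 0 < q := by rw [hq]; positivity
  have hqle : q ≤ min (X.ncard - 1) (Y.ncard - 1) := by
    rw [hq']
    exact Nat.pow_log_le_self 2 (by omega)
  have hqlt : min (X.ncard - 1) (Y.ncard - 1) < 2 * q := by
    rw [hq', ← pow_succ']
    exact Nat.lt_pow_succ_log_self (by norm_num) _
  rw [← hq]
  obtain ⟨p, hp⟩ := (hXY.gridUSO hP hn O hO).existsUnique_index (i := q) (j := q)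
    (by omega) (by omega)
  have hdeg : ∀ v, O.refinedOutdegree X Y v = (q, q) ↔ v = hXY.vertex p := by
    intro v
    obtain ⟨r, rfl⟩ := hXY.vertex_surjective v
    rw [hXY.refinedOutdegree_vertex hP hn O hO, Prod.mk.injEq, hp,
      hXY.vertex_injective.eq_iff]
  refine ⟨hXY.vertex p, hdeg, fun Ω _ μ _ v₀ v hv => ?_⟩
  have hw := (hdeg _).2 rfl
  have hlog : 1 ≤ Real.log n := by
    have hXYn : X.ncard + Y.ncard = n := by
      rw [← Set.ncard_union_eq hXY.disjoint, hXY.union_eq, Set.ncard_univ, Nat.card_fin]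
    have h4 : (3 : ℝ) ≤ n := by exact_mod_cast (by omega : 3 ≤ n)
    rw [Real.le_log_iff_exp_le (by linarith)]
    exact Real.exp_one_lt_three.le.trans h4
  refine le_trans ?_ (ENNReal.ofReal_le_ofReal
    (show 36 * (1 + Real.log n) + 9 ≤ 81 * Real.log n by linarith))
  -- The smaller side has at most `2q` elements and takes the role of the columns; the outdegree
  -- `(q, q)` is symmetric under the exchange.
  rcases le_total X.ncard Y.ncard with hle | hle
  · exact hXY.lintegral_firstHit_reachable_le hP hn O hO hq0 (by omega) hw μ hv
  · refine hXY.swap.lintegral_firstHit_reachable_le hP hn O hO hq0 (by omega) ?_ μ hv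
    rw [FacetPolytope.Orientation.refinedOutdegree, Prod.mk.injEq] at hw ⊢
    exact hw.symm
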